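/- **Corollary 1 (gap between the upper and lower bounds).** Let $\sigma_X^2>0$, $\sigma_Z^2\ge 0$ and $\rho_X,\rho_Z\in[0,1]$. Put $\sigma_Y^2=\sigma_X^2+\sigma_Z^2$, $\rho_Y=\frac{\rho_X\sigma_X^2+\rho_Z\sigma_Z^2}{\sigma_Y^2}$ and, for an integer $L\ge 2$ and $*\in\{X,Y,Z\}$, $$\lambda_*=(1+(L-1)\rho_*)\sigma_*^2,\qquad \gamma_*=(1-\rho_*)\sigma_*^2,$$ and assume $\min(\lambda_Y,\gamma_Y)>0$ for all $L$. Let $d_{\min}=\frac{\lambda_X\lambda_Z}{L\lambda_Y}+\frac{(L-1)\gamma_X\gamma_Z}{L\gamma_Y}$. For $d_{\min}<D<\sigma_X^2$ let $$\overline{\mathcal R}(D)=\tfrac12\log\Big(1+\frac{\lambda_Y}{\lambda_Q}\Big)+\tfrac{L-1}2\log\Big(1+\frac{\gamma_Y}{\lambda_Q}\Big),$$ where $\lambda_Q$ is the positive solution of $\lambda_X\big(1-\frac{\lambda_X}{\lambda_Y+\lambda_Q}\big)+(L-1)\gamma_X\big(1-\frac{\gamma_X}{\gamma_Y+\lambda_Q}\big)=LD$,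 and, with $\lambda_W=\min(\lambda_Y,\gamma_Y)$, let $$\underline{\mathcal R}(D)=\min_{\alpha,\beta,\delta}\;\tfrac12\log\frac{\lambda_Y^2}{(\lambda_Y-\lambda_W)\alpha+\lambda_Y\lambda_W}+\tfrac{L-1}2\log\frac{\gamma_Y^2}{(\gamma_Y-\lambda_W)\beta+\gamma_Y\lambda_W}+\tfrac L2\log\frac{\lambda_W}{\delta}$$ over all $0<\alpha\le\lambda_Y$, $0<\beta\le\gamma_Y$, $\delta>0$ with $\delta\le(\alpha^{-1}+\lambda_W^{-1}-\lambda_Y^{-1})^{-1}$, $\delta\le(\beta^{-1}+\lambda_W^{-1}-\gamma_Y^{-1})^{-1}$ and $$\lambda_X^2\lambda_Y^{-2}\alpha+\lambda_X-\lambda_X^2\lambda_Y^{-1}+(L-1)\big(\gamma_X^2\gamma_Y^{-2}\beta+\gamma_X-\gamma_X^2\gamma_Y^{-1}\big)\le LD.$$ Let $d^\infty_{\min}=\frac{\sigma_X^2\sigma_Z^2}{\sigma_X^2+\sigma_Z^2}$ if $\rho_X\sigma_X^2+\rho_Z\sigma_Z^2=0$, and $d^\infty_{\min}=\frac{\rho_X\rho_Z\sigma_X^2\sigma_Z^2}{\rho_X\sigma_X^2+\rho_Z\sigma_Z^2}+\frac{\gamma_X\gamma_Z}{\gamma_Y}$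 otherwise. If $\rho_X\sigma_X^2+\rho_Z\sigma_Z^2>0$, let $$\xi=\frac{\rho_X}{1-\rho_X}\cdot\frac{1-\rho_Y}{\rho_Y}\quad(\xi=+\infty\text{ if }\rho_X=1),\qquad \mathsf D^\infty_{\mathrm{th},0}=\frac{\rho_X\rho_Z\sigma_X^2\sigma_Z^2}{\rho_X\sigma_X^2+\rho_Z\sigma_Z^2}+\gamma_X,$$ and, if moreover $\rho_X>0$ and $\xi<\frac12$, $$\mathsf D^\infty_{\mathrm{th},1}=\mathsf D^\infty_{\mathrm{th},0}-\frac{1+\sqrt{1-4\xi^2}}2\,\frac{\gamma_X^2}{\gamma_Y},\qquad \mathsf D^\infty_{\mathrm{th},2}=\mathsf D^\infty_{\mathrm{th},0}-\frac{1-\sqrt{1-4\xi^2}}2\,\frac{\gamma_X^2}{\gamma_Y},$$ $$\Delta^\infty_R(D)=\frac{(\mathsf D^\infty_{\mathrm{th},1}-D)(\mathsf D^\infty_{\mathrm{th},2}-D)}{2(\mathsf D^\infty_{\mathrm{th},0}-D)(D-d^\infty_{\min})}+\frac12\log\Big(\frac{\gamma_Y^2}{\xi^2\gamma_X^4}(\mathsf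 D^\infty_{\mathrm{th},0}-D)(D-d^\infty_{\min})\Big).$$ Fix $D\in(d^\infty_{\min},\sigma_X^2)$. Then $d_{\min}<D$ for all sufficiently large $L$; for every $L\ge2$ with $d_{\min}<D$ the number $\lambda_Q$ exists and is unique and the minimum defining $\underline{\mathcal R}(D)$ is attained; and: 1. If $\rho_X\sigma_X^2+\rho_Z\sigma_Z^2=0$, then for every $L\ge 2$ we have $d_{\min}<D$ and $\overline{\mathcal R}(D)-\underline{\mathcal R}(D)=0$. 2. If $\rho_X\sigma_X^2+\rho_Z\sigma_Z^2>0$, $\rho_X>0$ and $\xi\ge\frac12$, then $\overline{\mathcal R}(D)-\underline{\mathcal R}(D)=0$ for every $L\ge2$ with $d_{\min}<D$, hence for all sufficiently large $L$. 3. If $\rho_X\sigma_X^2+\rho_Z\sigma_Z^2>0$, $\rho_X>0$ and $\xi<\frac12$, then $\lim_{L\to\infty}\big(\overline{\mathcal R}(D)-\underline{\mathcal R}(D)\big)$ equals $0$ if $D\le\mathsf D^\infty_{\mathrm{th},1}$ or $D\ge\mathsf D^\infty_{\mathrm{th},2}$, and equals $\Delta^\infty_R(D)$ if $\mathsf D^\infty_{\mathrm{th},1}<D<\mathsf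 D^\infty_{\mathrm{th},2}$. 4. If $\rho_X\sigma_X^2+\rho_Z\sigma_Z^2>0$ and $\rho_X=0$, then $\overline{\mathcal R}(D)-\underline{\mathcal R}(D)=O(\log L)$ as $L\to\infty$. -/

import Mathlib

open Filter Topology Asymptotics

/-- The parameters of the symmetric Gaussian model `Y = X + Z`: for `L` encoders the covariance
matrix of `X` has diagonal entries `varX` (the paper's `σ_X²`) and off-diagonal entries
`rhoX * varX`, and likewise for `Z`. -/
structure SymGaussian where
  /-- the variance `σ_X²` -/
  varX : ℝ
  /-- the variance `σ_Z²` -/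
  varZ : ℝ
  /-- the correlation coefficient `ρ_X` -/
  rhoX : ℝ
  /-- the correlation coefficient `ρ_Z` -/
  rhoZ : ℝ

noncomputable section

namespace SymGaussian

variable (P : SymGaussian)

/-! ### The observations and the eigenvalues of the covariance matrices -/

/-- `ρ_X σ_X² + ρ_Z σ_Z²`, the off-diagonal entry of the covariance matrix of `Y`. -/
def covY : ℝ := P.rhoX * P.varX + P.rhoZ * P.varZ

/-- `σ_Y² = σ_X² + σ_Z²`. -/
def varY : ℝ := P.varX + P.varZ

/-- `ρ_Y`, determined by `ρ_Y σ_Y² = ρ_X σ_X² + ρ_Z σ_Z²`. -/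
def rhoY : ℝ := P.covY / P.varY

/-- `λ_X = (1 + (L - 1) ρ_X) σ_X²`. -/
def lamX (L : ℕ) : ℝ := (1 + ((L : ℝ) - 1) * P.rhoX) * P.varX

/-- `λ_Z = (1 + (L - 1) ρ_Z) σ_Z²`. -/
def lamZ (L : ℕ) : ℝ := (1 + ((L : ℝ) - 1) * P.rhoZ) * P.varZ

/-- `λ_Y = (1 + (L - 1) ρ_Y) σ_Y²`. -/
def lamY (L : ℕ) : ℝ := (1 + ((L : ℝ) - 1) * P.rhoY) * P.varY

/-- `γ_X = (1 - ρ_X) σ_X²`. -/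
def gamX : ℝ := (1 - P.rhoX) * P.varX

/-- `γ_Z = (1 - ρ_Z) σ_Z²`. -/
def gamZ : ℝ := (1 - P.rhoZ) * P.varZ

/-- `γ_Y = (1 - ρ_Y) σ_Y²`. -/
def gamY : ℝ := (1 - P.rhoY) * P.varY

/-- `d_min`, the smallest distortion for `L` encoders. -/
def dMin (L : ℕ) : ℝ :=
  P.lamX L * P.lamZ L / ((L : ℝ) * P.lamY L)
    + ((L : ℝ) - 1) * P.gamX * P.gamZ / ((L : ℝ) * P.gamY)

/-! ### The upper bound -/

/-- `q` is a positive number solving the distortion equation that determines `λ_Q`. -/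
def IsLamQ (L : ℕ) (D q : ℝ) : Prop :=
  0 < q ∧
    P.lamX L * (1 - P.lamX L / (P.lamY L + q))
      + ((L : ℝ) - 1) * P.gamX * (1 - P.gamX / (P.gamY + q)) = (L : ℝ) * D

/-- `λ_Q`, the positive solution of the distortion equation. -/
def lamQ (L : ℕ) (D : ℝ) : ℝ := Classical.epsilon (P.IsLamQ L D)

/-- The upper bound on the rate-distortion function. -/
def upperRate (L : ℕ) (D : ℝ) : ℝ :=
  1 / 2 * Real.log (1 + P.lamY L / P.lamQ L D)
    + ((L : ℝ) - 1) / 2 * Real.log (1 + P.gamY / P.lamQ L D)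

/-! ### The lower bound -/

/-- `λ_W = min(λ_Y, γ_Y)`. -/
def lamW (L : ℕ) : ℝ := min (P.lamY L) P.gamY

/-- The objective function `Ω(α, β, δ)`. -/
def Omega (L : ℕ) (α β δ : ℝ) : ℝ :=
  1 / 2 * Real.log
      (P.lamY L ^ 2 / ((P.lamY L - P.lamW L) * α + P.lamY L * P.lamW L))
    + ((L : ℝ) - 1) / 2 * Real.log
      (P.gamY ^ 2 / ((P.gamY - P.lamW L) * β + P.gamY * P.lamW L))
    + (L : ℝ) / 2 * Real.log (P.lamW L / δ)

/-- The constraints of the minimization program. -/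
def Feasible (L : ℕ) (D α β δ : ℝ) : Prop :=
  (0 < α ∧ α ≤ P.lamY L) ∧ (0 < β ∧ β ≤ P.gamY) ∧ 0 < δ ∧
  δ ≤ (α⁻¹ + (P.lamW L)⁻¹ - (P.lamY L)⁻¹)⁻¹ ∧
  δ ≤ (β⁻¹ + (P.lamW L)⁻¹ - P.gamY⁻¹)⁻¹ ∧
  P.lamX L ^ 2 / P.lamY L ^ 2 * α + P.lamX L - P.lamX L ^ 2 / P.lamY L
    + ((L : ℝ) - 1) * (P.gamX ^ 2 / P.gamY ^ 2 * β + P.gamX - P.gamX ^ 2 / P.gamY)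
    ≤ (L : ℝ) * D

/-- The values that the objective function takes under the constraints. -/
def feasibleValues (L : ℕ) (D : ℝ) : Set ℝ :=
  {r | ∃ α β δ : ℝ, P.Feasible L D α β δ ∧ r = P.Omega L α β δ}

/-- The lower bound on the rate-distortion function: the minimum of the program. -/
def lowerRate (L : ℕ) (D : ℝ) : ℝ := sInf (P.feasibleValues L D)

/-- The gap between the upper and the lower bound. -/
def gap (L : ℕ) (D : ℝ) : ℝ := P.upperRate L D - P.lowerRate L D

/-! ### The limiting quantities -/

open Classical in
/-- `d_min^∞`. -/
def dMinInf : ℝ :=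
  if P.covY = 0 then P.varX * P.varZ / (P.varX + P.varZ)
  else P.rhoX * P.rhoZ * P.varX * P.varZ / P.covY + P.gamX * P.gamZ / P.gamY

/-- `D_{th,0}^∞`. -/
def dTh0 : ℝ := P.rhoX * P.rhoZ * P.varX * P.varZ / P.covY + P.gamX

/-- `ξ`, for `ρ_X < 1`. -/
def xi : ℝ := P.rhoX / (1 - P.rhoX) * ((1 - P.rhoY) / P.rhoY)

/-- `D_{th,1}^∞`. -/
def dTh1 : ℝ :=
  P.rhoX * P.rhoZ * P.varX * P.varZ / P.covY + P.gamX
    - (1 + Real.sqrt (1 - 4 * P.xi ^ 2)) / 2 * (P.gamX ^ 2 / P.gamY)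

/-- `D_{th,2}^∞`. -/
def dTh2 : ℝ :=
  P.rhoX * P.rhoZ * P.varX * P.varZ / P.covY + P.gamX
    - (1 - Real.sqrt (1 - 4 * P.xi ^ 2)) / 2 * (P.gamX ^ 2 / P.gamY)

/-- `Δ_R^∞(D)`. -/
def deltaInf (D : ℝ) : ℝ :=
  (P.dTh1 - D) * (P.dTh2 - D) / (2 * (P.dTh0 - D) * (D - P.dMinInf))
    + 1 / 2 * Real.log
      (P.gamY ^ 2 / (P.xi ^ 2 * P.gamX ^ 4) * ((P.dTh0 - D) * (D - P.dMinInf)))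

end SymGaussian

end

/-! ### A concave program in two variables -/

/-! Nonnegative correlations give `λ_Y ≥ γ_Y`, so `λ_W = γ_Y`. The `β` term of the objective then
vanishes from the optimization, and one may take `β = δ`. With `κ = 1/γ_Y - 1/λ_Y`, what remains is
to maximize the concave function `log (1 + κ α) + L log δ` under a concave constraint `δ (1 + κ α) ≤
α` and a linear one `A α + (L - 1) B δ ≤ L (D - d_min)`. The upper bound is the same objective at
the corner `(α_Q, δ_Q)`, where both constraints are active. Hence the gap is half the excess of the
maximum over the corner value.

By concavity the corner is optimal once the multiplier of the first constraint is nonnegative, that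
is, `(L - 1) B δ_Q (α_Q - δ_Q) ≤ L A α_Q²` (`log_add_mul_log_le_of_corner`). The maximum over the
linear constraint alone is explicit (`log_add_mul_log_le_of_line`); it always bounds the gap, and it
equals the gap when its maximizer satisfies the other constraints.

Put `x = δ_Q / α_Q`. If `ξ ≥ 1/2`, then `B / 4 ≤ A`, and `x (1 - x) ≤ 1/4` settles every `L`. If `0
< ξ < 1/2`, then `A / B → ξ²`, while for `D < D_{th,0}` the limit of `x` is `(D_{th,0} - D) γ_Y /
γ_X²`; the thresholds are the solutions of `x (1 - x) = ξ²`. Between them the line maximizer is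
eventually feasible, and expanding `L log (δ_line / δ_Q)` to first order gives `Δ_R^∞`. If `ρ_X =
0`, then `A α` stays bounded, which pins `L log δ` up to a constant and leaves only `log (1 + κ α) =
O(log L)`. -/

lemma log_le_log_add_div {x y : ℝ} (hx : 0 < x) (hy : 0 < y) :
    Real.log x ≤ Real.log y + (x - y) / y := by
  have h := Real.log_le_sub_one_of_pos (div_pos hx hy)
  rw [Real.log_div hx.ne' hy.ne'] at h
  have : (x - y) / y = x / y - 1 := by field_simp
  linarith

/-- The tangent line of the concave map `x ↦ x / (1 + κ x)`. -/
lemma sub_le_tangent {κ a d a' d' : ℝ} (hκ : 0 ≤ κ) (ha : 0 < a) (ha' : 0 < a')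
    (hd : d * (1 + κ * a) ≤ a) (hd' : d' * (1 + κ * a') = a') :
    d - d' ≤ (d' / a') ^ 2 * (a - a') := by
  have h1 : 0 < 1 + κ * a := by positivity
  have h2 : 0 < 1 + κ * a' := by positivity
  have e1 : d ≤ a / (1 + κ * a) := (le_div_iff₀ h1).2 hd
  have e2 : d' = a' / (1 + κ * a') := (eq_div_iff h2.ne').2 hd'
  have e3 : (d' / a') ^ 2 * (a - a') - (a / (1 + κ * a) - d')
      = κ * (a - a') ^ 2 / ((1 + κ * a) * (1 + κ * a') ^ 2) := by
    rw [e2]; field_simp; ring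
  have : 0 ≤ κ * (a - a') ^ 2 / ((1 + κ * a) * (1 + κ * a') ^ 2) := by positivity
  linarith

/-- Under a sign condition on the multiplier, the point where both constraints are active maximizes
`log (1 + κ a) + n log d`. -/
lemma log_add_mul_log_le_of_corner {κ n A B a d a' d' : ℝ} (hκ : 0 ≤ κ) (hn : 1 ≤ n)
    (hA : 0 < A) (hB : 0 ≤ B) (ha : 0 < a) (hd0 : 0 < d) (ha' : 0 < a') (hd0' : 0 < d')
    (hd : d * (1 + κ * a) ≤ a) (hd' : d' * (1 + κ * a') = a')
    (hline : A * a + (n - 1) * B * d ≤ A * a' + (n - 1) * B * d')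
    (hmul : (n - 1) * B * (d' * (a' - d')) ≤ n * A * a' ^ 2) :
    Real.log (1 + κ * a) + n * Real.log d ≤ Real.log (1 + κ * a') + n * Real.log d' := by
  have h1 : 0 < 1 + κ * a := by positivity
  have h2 : 0 < 1 + κ * a' := by positivity
  have t1 := log_le_log_add_div h1 h2
  have t2 := mul_le_mul_of_nonneg_left (log_le_log_add_div hd0 hd0') (by linarith : 0 ≤ n)
  have tan := sub_le_tangent hκ ha ha' hd hd'
  have hn1 : 0 ≤ n - 1 := by linarith
  set S := A * a' ^ 2 + (n - 1) * B * d' ^ 2 with hS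
  have hSpos : 0 < S := by positivity
  -- Lagrange identity at the corner: the first-order increment of the objective is a combination of
  -- the slacks of the linearized first constraint and of the line, with both multipliers scaled by
  -- `S`. The hypothesis `hmul` makes the first multiplier nonnegative.
  have key : (1 + κ * a - (1 + κ * a')) / (1 + κ * a') + n * ((d - d') / d')
      = ((n * A * a' ^ 2 - (n - 1) * B * (d' * (a' - d'))) / d'
          * ((d - d') - (d' / a') ^ 2 * (a - a'))
        + (a' + (n - 1) * d') * ((A * a + (n - 1) * B * d) - (A * a' + (n - 1) * B * d'))) / S := by
    have e : κ = (a' - d') / (a' * d') := by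
      field_simp; linarith
    have e2 : 1 + κ * a' = a' / d' := by field_simp; linarith
    rw [e2, eq_div_iff hSpos.ne', hS, show 1 + κ * a - a' / d' = κ * (a - a') by rw [← e2]; ring, e]
    field_simp
    ring
  have : (1 + κ * a - (1 + κ * a')) / (1 + κ * a') + n * ((d - d') / d') ≤ 0 := by
    rw [key]
    apply div_nonpos_of_nonpos_of_nonneg _ hSpos.le
    have p1 : 0 ≤ (n * A * a' ^ 2 - (n - 1) * B * (d' * (a' - d'))) / d' :=
      div_nonneg (by linarith) hd0'.le
    have p2 : 0 ≤ a' + (n - 1) * d' := by positivity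
    have q1 := mul_nonneg p1 (sub_nonneg.2 tan)
    have q2 := mul_nonneg p2 (sub_nonneg.2 hline)
    nlinarith
  linarith

/-- The maximum of `log (1 + κ a) + n log d` on the line `A a + (n - 1) B d = M`. -/
lemma log_add_mul_log_le_of_line {κ n A B M a d : ℝ} (hκ : 0 < κ) (hn : 1 < n)
    (hA : 0 < A) (hB : 0 < B) (hM : 0 < M) (ha : 0 < a) (hd0 : 0 < d)
    (hline : A * a + (n - 1) * B * d ≤ M) :
    Real.log (1 + κ * a) + n * Real.log d
      ≤ Real.log ((κ * M + A) / ((n + 1) * A))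
        + n * Real.log (n * (M + A / κ) / ((n + 1) * (n - 1) * B)) := by
  -- Weighted AM-GM: the budget `M + A / κ` for `A (a + 1/κ) + (n - 1) B d` is split in the
  -- proportion `1 : n`. This gives the two arguments of the logarithms, and the tangents there add
  -- up to a multiple of the line constraint.
  have hn1 : 0 < n - 1 := by linarith
  have h1 : 0 < 1 + κ * a := by positivity
  have h2 : 0 < (κ * M + A) / ((n + 1) * A) := by positivity
  have h3 : 0 < n * (M + A / κ) / ((n + 1) * (n - 1) * B) := by positivity
  have t1 := log_le_log_add_div h1 h2
  have t2 := mul_le_mul_of_nonneg_left (log_le_log_add_div hd0 h3) (by linarith : 0 ≤ n)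
  have h4 : 0 < κ * M + A := by positivity
  have key : (1 + κ * a - (κ * M + A) / ((n + 1) * A)) / ((κ * M + A) / ((n + 1) * A))
      + n * ((d - n * (M + A / κ) / ((n + 1) * (n - 1) * B))
        / (n * (M + A / κ) / ((n + 1) * (n - 1) * B)))
      = (n + 1) * κ / (κ * M + A) * (A * a + (n - 1) * B * d - M) := by
    have : M + A / κ = (κ * M + A) / κ := by field_simp
    rw [this]
    field_simp
    ring
  have : (n + 1) * κ / (κ * M + A) * (A * a + (n - 1) * B * d - M) ≤ 0 :=
    mul_nonpos_of_nonneg_of_nonpos (by positivity) (by linarith)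
  linarith

/-- The maximum of `log (1 + κ a) + n log d` over the feasible set is attained. -/
lemma exists_isMax_log_add_mul_log {κ n A B M l a' d' : ℝ} (hκ : 0 ≤ κ) (hn : 0 < n)
    (ha' : 0 < a') (hal' : a' ≤ l) (hd0' : 0 < d') (hd' : d' * (1 + κ * a') ≤ a')
    (hline' : A * a' + (n - 1) * B * d' ≤ M) :
    ∃ a d : ℝ, (0 < a ∧ a ≤ l ∧ 0 < d ∧ d * (1 + κ * a) ≤ a ∧ A * a + (n - 1) * B * d ≤ M) ∧
      ∀ x y : ℝ, 0 < x → x ≤ l → 0 < y → y * (1 + κ * x) ≤ x → A * x + (n - 1) * B * y ≤ M →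
        Real.log (1 + κ * x) + n * Real.log y ≤ Real.log (1 + κ * a) + n * Real.log d := by
  have hl : 0 < l := ha'.trans_le hal'
  set c := Real.log (1 + κ * l) with hc
  have hc0 : 0 ≤ c := Real.log_nonneg (by nlinarith)
  -- The feasible set is not compact, as `d` may tend to `0`. Since the first logarithm is at most
  -- `c`, a point with `d < d₀` does no better than `(a', d')`, so the search may be restricted to
  -- `d ≥ d₀`; then `a ≥ d ≥ d₀` as well.
  set d₀ := d' * Real.exp (-c / n) with hd₀
  have hd₀pos : 0 < d₀ := by positivity
  have hd₀le : d₀ ≤ d' := by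
    apply mul_le_of_le_one_right hd0'.le
    apply Real.exp_le_one_iff.2
    apply div_nonpos_of_nonpos_of_nonneg _ hn.le
    linarith
  have hlogd₀ : n * Real.log d₀ = n * Real.log d' - c := by
    rw [hd₀, Real.log_mul hd0'.ne' (Real.exp_pos _).ne', Real.log_exp]
    field_simp
    ring
  have hle : ∀ x y : ℝ, 0 < x → 0 < y → y * (1 + κ * x) ≤ x → y ≤ x := by
    intro x y hx hy h
    nlinarith [mul_nonneg (mul_nonneg hκ hx.le) hy.le]
  let K : Set (ℝ × ℝ) := (Set.Icc d₀ l ×ˢ Set.Icc d₀ l) ∩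
    {p | p.2 * (1 + κ * p.1) ≤ p.1 ∧ A * p.1 + (n - 1) * B * p.2 ≤ M}
  have hK : IsCompact K := by
    apply (isCompact_Icc.prod isCompact_Icc).inter_right
    exact (isClosed_le (f := fun p : ℝ × ℝ => p.2 * (1 + κ * p.1)) (g := fun p => p.1)
      (by fun_prop) (by fun_prop)).inter
      (isClosed_le (f := fun p : ℝ × ℝ => A * p.1 + (n - 1) * B * p.2) (g := fun _ => M)
      (by fun_prop) (by fun_prop))
  have hmem' : (a', d') ∈ K := by
    have := hle a' d' ha' hd0' hd'
    exact ⟨⟨⟨by simpa using hd₀le.trans this, by simpa using hal'⟩,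
      ⟨by simpa using hd₀le, by simpa using this.trans hal'⟩⟩, hd', hline'⟩
  have hcont : ContinuousOn (fun p : ℝ × ℝ => Real.log (1 + κ * p.1) + n * Real.log p.2) K := by
    apply ContinuousOn.add
    · apply ContinuousOn.log (by fun_prop)
      rintro p ⟨⟨⟨h1, -⟩, -⟩, -⟩
      have : 0 < p.1 := hd₀pos.trans_le h1
      positivity
    · apply ContinuousOn.mul (by fun_prop)
      apply ContinuousOn.log (by fun_prop)
      rintro p ⟨⟨-, ⟨h1, -⟩⟩, -⟩
      exact (hd₀pos.trans_le h1).ne'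
  obtain ⟨⟨a, d⟩, hp, hmax⟩ := hK.exists_isMaxOn ⟨_, hmem'⟩ hcont
  obtain ⟨⟨⟨h1, h2⟩, ⟨h3, -⟩⟩, h5, h6⟩ := hp
  refine ⟨a, d, ⟨hd₀pos.trans_le h1, h2, hd₀pos.trans_le h3, h5, h6⟩, ?_⟩
  intro x y hx hxl hy hyx hxy
  rcases le_or_gt d₀ y with h | h
  · have hyx' := hle x y hx hy hyx
    exact isMaxOn_iff.1 hmax (x, y)
      ⟨⟨⟨h.trans hyx', hxl⟩, ⟨h, hyx'.trans hxl⟩⟩, hyx, hxy⟩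
  · have m := isMaxOn_iff.1 hmax (a', d') hmem'
    have e1 : Real.log (1 + κ * x) ≤ c := Real.log_le_log (by positivity) (by gcongr)
    have e2 := mul_le_mul_of_nonneg_left (Real.log_le_log hy h.le) hn.le
    have e3 : 0 ≤ Real.log (1 + κ * a') := Real.log_nonneg (by nlinarith)
    simp only at m
    linarith

/-! ### Reduction to two variables and existence of `λ_Q` -/

noncomputable section

namespace SymGaussian

variable (P : SymGaussian)

/-- The admissible parameters. -/
structure Admissible : Prop where
  varX_pos : 0 < P.varX
  varZ_nonneg : 0 ≤ P.varZ
  rhoX_nonneg : 0 ≤ P.rhoX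
  rhoX_le_one : P.rhoX ≤ 1
  rhoZ_nonneg : 0 ≤ P.rhoZ
  rhoZ_le_one : P.rhoZ ≤ 1
  gamY_pos : 0 < P.gamY

/-- The difference of the reciprocals of the two eigenvalues of the covariance matrix of `Y`. -/
def kappa (L : ℕ) : ℝ := P.gamY⁻¹ - (P.lamY L)⁻¹

/-- The coefficient of `α` in the distortion constraint. -/
def coefA (L : ℕ) : ℝ := P.lamX L ^ 2 / P.lamY L ^ 2

/-- The coefficient of `β` in the distortion constraint. -/
def coefB : ℝ := P.gamX ^ 2 / P.gamY ^ 2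

/-- The part of the objective that depends on the variables, with the sign reversed. -/
def payoff (L : ℕ) (α δ : ℝ) : ℝ := Real.log (1 + P.kappa L * α) + (L : ℝ) * Real.log δ

/-- The constraints after the elimination of `β`. -/
def ReducedFeasible (L : ℕ) (D α δ : ℝ) : Prop :=
  0 < α ∧ α ≤ P.lamY L ∧ 0 < δ ∧ δ * (1 + P.kappa L * α) ≤ α ∧
    P.coefA L * α + ((L : ℝ) - 1) * P.coefB * δ ≤ (L : ℝ) * (D - P.dMin L)

variable {P}

namespace Admissible

variable (h : P.Admissible)
include h

lemma varY_pos : 0 < P.varY := by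
  have := h.varX_pos; have := h.varZ_nonneg; unfold varY; linarith

lemma rhoY_mul : P.rhoY * P.varY = P.covY := by
  unfold rhoY; field_simp [h.varY_pos.ne']

lemma covX_nonneg : 0 ≤ P.rhoX * P.varX := mul_nonneg h.rhoX_nonneg h.varX_pos.le
lemma covZ_nonneg : 0 ≤ P.rhoZ * P.varZ := mul_nonneg h.rhoZ_nonneg h.varZ_nonneg
lemma covY_nonneg : 0 ≤ P.covY := add_nonneg h.covX_nonneg h.covZ_nonneg

lemma gamX_nonneg : 0 ≤ P.gamX := mul_nonneg (by linarith [h.rhoX_le_one]) h.varX_pos.le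

lemma gamY_eq : P.gamY = P.varX + P.varZ - P.covY := by
  have := h.rhoY_mul; unfold gamY; rw [sub_mul, this, varY]; ring

lemma gamX_add_gamZ : P.gamX + P.gamZ = P.gamY := by
  rw [h.gamY_eq]; unfold gamX gamZ covY; ring

lemma lamY_eq (L : ℕ) : P.lamY L = P.gamY + L * P.covY := by
  have := h.rhoY_mul
  rw [h.gamY_eq]; unfold lamY
  rw [add_mul, mul_assoc, this, varY]; ring

omit h in
lemma lamX_eq (P : SymGaussian) (L : ℕ) : P.lamX L = P.gamX + L * (P.rhoX * P.varX) := by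
  unfold lamX gamX; ring

omit h in
lemma lamZ_eq (P : SymGaussian) (L : ℕ) : P.lamZ L = P.gamZ + L * (P.rhoZ * P.varZ) := by
  unfold lamZ gamZ; ring

lemma lamX_add_lamZ (L : ℕ) : P.lamX L + P.lamZ L = P.lamY L := by
  rw [h.lamY_eq, lamX_eq, lamZ_eq, ← h.gamX_add_gamZ]; unfold covY; ring

lemma gamY_le_lamY (L : ℕ) : P.gamY ≤ P.lamY L := by
  rw [h.lamY_eq]; have := h.covY_nonneg; have : 0 ≤ (L : ℝ) * P.covY := by positivity
  linarith

lemma lamY_pos (L : ℕ) : 0 < P.lamY L := h.gamY_pos.trans_le (h.gamY_le_lamY L)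

lemma lamW_eq (L : ℕ) : P.lamW L = P.gamY := min_eq_right (h.gamY_le_lamY L)

lemma lamX_pos {L : ℕ} (hL : 2 ≤ L) : 0 < P.lamX L := by
  unfold lamX
  have : (2 : ℝ) ≤ L := by exact_mod_cast hL
  have : 0 ≤ ((L : ℝ) - 1) * P.rhoX := mul_nonneg (by linarith) h.rhoX_nonneg
  exact mul_pos (by linarith) h.varX_pos

lemma kappa_nonneg (L : ℕ) : 0 ≤ P.kappa L :=
  sub_nonneg.2 (inv_anti₀ h.gamY_pos (h.gamY_le_lamY L))

lemma coefA_pos {L : ℕ} (hL : 2 ≤ L) : 0 < P.coefA L := by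
  have := h.lamX_pos hL; have := h.lamY_pos L; unfold coefA; positivity

omit h in
lemma coefB_nonneg (P : SymGaussian) : 0 ≤ P.coefB := by unfold coefB; positivity

lemma mul_dMin {L : ℕ} (hL : 2 ≤ L) :
    (L : ℝ) * P.dMin L = P.lamX L - P.lamX L ^ 2 / P.lamY L
      + ((L : ℝ) - 1) * (P.gamX - P.gamX ^ 2 / P.gamY) := by
  have hL0 : (L : ℝ) ≠ 0 := by positivity
  have h1 := (h.lamY_pos L).ne'
  have h2 := h.gamY_pos.ne'
  unfold dMin
  rw [show P.lamZ L = P.lamY L - P.lamX L by linarith [h.lamX_add_lamZ L],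
    show P.gamZ = P.gamY - P.gamX by linarith [h.gamX_add_gamZ]]
  field_simp

lemma gamY_mul (L : ℕ) : P.gamY * (1 + P.kappa L * P.lamY L) = P.lamY L := by
  have h1 := (h.lamY_pos L).ne'
  have h2 := h.gamY_pos.ne'
  unfold kappa; field_simp; ring

lemma le_gamY_of_reducedFeasible {L : ℕ} {D α δ : ℝ} (hf : P.ReducedFeasible L D α δ) :
    δ ≤ P.gamY := by
  obtain ⟨h1, h2, h3, h4, -⟩ := hf
  have hk := h.kappa_nonneg L
  have hg := h.gamY_mul L
  have p1 : 0 < 1 + P.kappa L * α := by positivity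
  have p2 : 0 < 1 + P.kappa L * P.lamY L := by have := h.lamY_pos L; positivity
  have e1 : δ ≤ α / (1 + P.kappa L * α) := (le_div_iff₀ p1).2 h4
  have e2 : P.gamY = P.lamY L / (1 + P.kappa L * P.lamY L) := (eq_div_iff p2.ne').2 hg
  rw [e2]; refine e1.trans ?_
  rw [div_le_div_iff₀ p1 p2]
  nlinarith

lemma Omega_eq {L : ℕ} {α β δ : ℝ} (hα : 0 < α) (hδ : 0 < δ) :
    P.Omega L α β δ = 1 / 2 * (Real.log (P.lamY L) + ((L : ℝ) - 1) * Real.log P.gamY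
      - P.payoff L α δ) := by
  have hl := h.lamY_pos L
  have hg := h.gamY_pos
  have hk := h.kappa_nonneg L
  unfold Omega payoff
  rw [h.lamW_eq]
  have e1 : (P.lamY L - P.gamY) * α + P.lamY L * P.gamY
      = P.lamY L * P.gamY * (1 + P.kappa L * α) := by
    unfold kappa; field_simp; ring
  -- As `λ_W = γ_Y`, the coefficient of `β` is zero and the middle logarithm vanishes.
  have e2 : P.gamY ^ 2 / ((P.gamY - P.gamY) * β + P.gamY * P.gamY) = 1 := by
    rw [sub_self, zero_mul, zero_add, ← pow_two, div_self (by positivity)]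
  have p1 : 0 < 1 + P.kappa L * α := by positivity
  rw [e1, e2, Real.log_one, Real.log_div (by positivity) (by positivity), Real.log_pow,
    Real.log_mul (by positivity) p1.ne', Real.log_mul hl.ne' hg.ne', Real.log_div hg.ne' hδ.ne']
  push_cast; ring

lemma le_inv_iff {L : ℕ} {α δ : ℝ} (hα : 0 < α) :
    δ ≤ (α⁻¹ + P.gamY⁻¹ - (P.lamY L)⁻¹)⁻¹ ↔ δ * (1 + P.kappa L * α) ≤ α := by
  have hk := h.kappa_nonneg L
  have p1 : 0 < 1 + P.kappa L * α := by positivity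
  have : (α⁻¹ + P.gamY⁻¹ - (P.lamY L)⁻¹)⁻¹ = α / (1 + P.kappa L * α) := by
    rw [add_sub_assoc]
    change (α⁻¹ + P.kappa L)⁻¹ = _
    rw [inv_eq_one_div, div_eq_div_iff (by positivity) p1.ne']
    field_simp
  rw [this, le_div_iff₀ p1]

/-- With `λ_W = γ_Y` the second bound on `δ` is just `δ ≤ β`, and replacing `β` by `δ` only relaxes
the distortion constraint. -/
lemma reducedFeasible_of_feasible {L : ℕ} (hL : 2 ≤ L) {D α β δ : ℝ}
    (hf : P.Feasible L D α β δ) : P.ReducedFeasible L D α δ := by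
  obtain ⟨⟨h1, h2⟩, ⟨h3, h4⟩, h5, h6, h7, h8⟩ := hf
  rw [h.lamW_eq] at h6 h7
  rw [h.le_inv_iff h1] at h6
  rw [add_sub_cancel_right, inv_inv] at h7
  refine ⟨h1, h2, h5, h6, ?_⟩
  have hL1 : (2 : ℝ) ≤ L := by exact_mod_cast hL
  have := mul_le_mul_of_nonneg_left h7 (mul_nonneg (by linarith : 0 ≤ (L : ℝ) - 1) (coefB_nonneg P))
  rw [mul_sub, h.mul_dMin hL]
  unfold coefA coefB at *
  linarith

lemma feasible_of_reducedFeasible {L : ℕ} (hL : 2 ≤ L) {D α δ : ℝ}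
    (hf : P.ReducedFeasible L D α δ) : P.Feasible L D α δ δ := by
  have hg := h.le_gamY_of_reducedFeasible hf
  obtain ⟨h1, h2, h3, h4, h5⟩ := hf
  rw [mul_sub, h.mul_dMin hL] at h5
  refine ⟨⟨h1, h2⟩, ⟨h3, hg⟩, h3, ?_, ?_, ?_⟩
  · rw [h.lamW_eq]; exact (h.le_inv_iff h1).2 h4
  · rw [h.lamW_eq, add_sub_cancel_right, inv_inv]
  · unfold coefA coefB at h5
    linarith

omit h in
-- This form makes the left side strictly decreasing in `q`, from which uniqueness and all estimates
-- of `λ_Q` follow.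
lemma isLamQ_iff {L : ℕ} {D q : ℝ} :
    P.IsLamQ L D q ↔ 0 < q ∧ P.lamX L ^ 2 / (P.lamY L + q)
      + ((L : ℝ) - 1) * (P.gamX ^ 2 / (P.gamY + q)) = (L : ℝ) * (P.varX - D) := by
  have e : P.lamX L + ((L : ℝ) - 1) * P.gamX = L * P.varX := by rw [lamX_eq]; unfold gamX; ring
  unfold IsLamQ
  refine and_congr_right fun _ => ?_
  have : P.lamX L * (1 - P.lamX L / (P.lamY L + q))
      + ((L : ℝ) - 1) * P.gamX * (1 - P.gamX / (P.gamY + q))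
      = P.lamX L + ((L : ℝ) - 1) * P.gamX - (P.lamX L ^ 2 / (P.lamY L + q)
      + ((L : ℝ) - 1) * (P.gamX ^ 2 / (P.gamY + q))) := by ring
  rw [this, e]
  constructor <;> intro <;> linarith

lemma residual_lt {L : ℕ} (hL : 2 ≤ L) {q q' : ℝ} (hq : 0 ≤ q) (hqq : q < q') :
    P.lamX L ^ 2 / (P.lamY L + q') + ((L : ℝ) - 1) * (P.gamX ^ 2 / (P.gamY + q'))
      < P.lamX L ^ 2 / (P.lamY L + q) + ((L : ℝ) - 1) * (P.gamX ^ 2 / (P.gamY + q)) := by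
  have hL1 : (2 : ℝ) ≤ L := by exact_mod_cast hL
  have hn : 0 ≤ (L : ℝ) - 1 := by linarith
  have := h.lamX_pos hL
  have := h.lamY_pos L
  have := h.gamY_pos
  apply add_lt_add_of_lt_of_le
  -- Strictness comes from the `λ_X` term, because `γ_X` may be zero.
  · exact div_lt_div_of_pos_left (by positivity) (by positivity) (by linarith)
  · gcongr

lemma existsUnique_isLamQ {L : ℕ} (hL : 2 ≤ L) {D : ℝ} (hD : P.dMin L < D) (hDX : D < P.varX) :
    ∃! q : ℝ, P.IsLamQ L D q := by
  have hL1 : (2 : ℝ) ≤ L := by exact_mod_cast hL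
  have hl := h.lamY_pos L
  have hg := h.gamY_pos
  set f : ℝ → ℝ := fun q => P.lamX L ^ 2 / (P.lamY L + q)
      + ((L : ℝ) - 1) * (P.gamX ^ 2 / (P.gamY + q)) with hf
  have hpos : 0 < (L : ℝ) * (P.varX - D) := mul_pos (by linarith) (by linarith)
  -- At `q = 0` the value is `L (σ_X² - d_min)`; at infinity it is `0`. The target lies strictly
  -- between.
  have h0 : (L : ℝ) * (P.varX - D) < f 0 := by
    have e : P.lamX L + ((L : ℝ) - 1) * P.gamX = L * P.varX := by
      rw [lamX_eq]; unfold gamX; ring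
    have := h.mul_dMin hL
    have : (L : ℝ) * P.dMin L < L * D := mul_lt_mul_of_pos_left hD (by linarith)
    simp only [hf, add_zero]
    linarith
  have hlim : Tendsto f atTop (𝓝 0) := by
    have t1 : Tendsto (fun q : ℝ => P.lamX L ^ 2 / (P.lamY L + q)) atTop (𝓝 0) :=
      Tendsto.div_atTop tendsto_const_nhds (tendsto_atTop_add_const_left _ _ tendsto_id)
    have t2 : Tendsto (fun q : ℝ => P.gamX ^ 2 / (P.gamY + q)) atTop (𝓝 0) :=
      Tendsto.div_atTop tendsto_const_nhds (tendsto_atTop_add_const_left _ _ tendsto_id)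
    simpa using t1.add (t2.const_mul ((L : ℝ) - 1))
  obtain ⟨b, hb, hb0⟩ := ((hlim.eventually (gt_mem_nhds hpos)).and (eventually_gt_atTop 0)).exists
  have hcont : ContinuousOn f (Set.Icc 0 b) := by
    apply ContinuousOn.add
    · apply ContinuousOn.div (by fun_prop) (by fun_prop)
      intro x hx; have := hx.1; positivity
    · apply ContinuousOn.mul (by fun_prop)
      apply ContinuousOn.div (by fun_prop) (by fun_prop)
      intro x hx; have := hx.1; positivity
  obtain ⟨q, hq, hfq⟩ := intermediate_value_Icc' hb0.le hcont ⟨hb.le, h0.le⟩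
  have hq0 : 0 < q := by
    rcases hq.1.eq_or_lt with e | e
    · rw [← e] at hfq; linarith
    · exact e
  refine ⟨q, isLamQ_iff.2 ⟨hq0, hfq⟩, ?_⟩
  intro y hy
  obtain ⟨hy0, hy1⟩ := isLamQ_iff.1 hy
  rcases lt_trichotomy y q with e | e | e
  · have := h.residual_lt hL hy0.le e
    simp only [hf] at hfq; linarith
  · exact e
  · have := h.residual_lt hL hq0.le e
    simp only [hf] at hfq; linarith

lemma isLamQ_lamQ {L : ℕ} (hL : 2 ≤ L) {D : ℝ} (hD : P.dMin L < D) (hDX : D < P.varX) :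
    P.IsLamQ L D (P.lamQ L D) :=
  Classical.epsilon_spec (h.existsUnique_isLamQ hL hD hDX).exists

end Admissible

/-! ### The gap at a fixed number of encoders -/

variable (P)

/-- The value of `α` that corresponds to the upper bound. -/
def alphaQ (L : ℕ) (D : ℝ) : ℝ := P.lamY L * P.lamQ L D / (P.lamY L + P.lamQ L D)

/-- The value of `δ` that corresponds to the upper bound. -/
def deltaQ (L : ℕ) (D : ℝ) : ℝ := P.gamY * P.lamQ L D / (P.gamY + P.lamQ L D)

/-- The value of `1 + κ α` at the maximizer of the payoff on the line given by the distortion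
constraint. -/
def lineTop (L : ℕ) (D : ℝ) : ℝ :=
  (P.kappa L * ((L : ℝ) * (D - P.dMin L)) + P.coefA L) / (((L : ℝ) + 1) * P.coefA L)

/-- The value of `δ` at the maximizer of the payoff on the line given by the distortion
constraint. -/
def lineDelta (L : ℕ) (D : ℝ) : ℝ :=
  (L : ℝ) * ((L : ℝ) * (D - P.dMin L) + P.coefA L / P.kappa L)
    / (((L : ℝ) + 1) * ((L : ℝ) - 1) * P.coefB)

variable {P}

namespace Admissible

variable (h : P.Admissible) {L : ℕ} (hL : 2 ≤ L) {D : ℝ} (hD : P.dMin L < D) (hDX : D < P.varX)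
include h hL hD hDX

lemma lamQ_pos : 0 < P.lamQ L D := (h.isLamQ_lamQ hL hD hDX).1

lemma alphaQ_pos : 0 < P.alphaQ L D := by
  have := h.lamY_pos L; have := h.lamQ_pos hL hD hDX
  unfold alphaQ; positivity

lemma deltaQ_pos : 0 < P.deltaQ L D := by
  have := h.gamY_pos; have := h.lamQ_pos hL hD hDX
  unfold deltaQ; positivity

lemma alphaQ_le_lamY : P.alphaQ L D ≤ P.lamY L := by
  have := h.lamY_pos L; have := h.lamQ_pos hL hD hDX
  unfold alphaQ
  rw [div_le_iff₀ (by positivity)]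
  nlinarith

/-- Reciprocals explain this: `1/α_Q = 1/λ_Y + 1/λ_Q` and `1/δ_Q = 1/γ_Y + 1/λ_Q`, which differ by
`κ`. -/
lemma deltaQ_mul : P.deltaQ L D * (1 + P.kappa L * P.alphaQ L D) = P.alphaQ L D := by
  have := h.lamY_pos L; have := h.lamQ_pos hL hD hDX; have := h.gamY_pos
  unfold deltaQ alphaQ kappa
  field_simp
  ring

/-- The equation for `λ_Q` says exactly that the distortion constraint is active at the corner. -/
lemma line_eq : P.coefA L * P.alphaQ L D + ((L : ℝ) - 1) * P.coefB * P.deltaQ L D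
    = (L : ℝ) * (D - P.dMin L) := by
  have hl := h.lamY_pos L
  have hq := h.lamQ_pos hL hD hDX
  have hg := h.gamY_pos
  have e := (isLamQ_iff.1 (h.isLamQ_lamQ hL hD hDX)).2
  have e2 : P.lamX L + ((L : ℝ) - 1) * P.gamX = L * P.varX := by
    rw [lamX_eq]; unfold gamX; ring
  rw [mul_sub, h.mul_dMin hL]
  have e3 : P.coefA L * P.alphaQ L D
      = P.lamX L ^ 2 / P.lamY L - P.lamX L ^ 2 / (P.lamY L + P.lamQ L D) := by
    unfold coefA alphaQ; field_simp; ring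
  have e4 : P.coefB * P.deltaQ L D
      = P.gamX ^ 2 / P.gamY - P.gamX ^ 2 / (P.gamY + P.lamQ L D) := by
    unfold coefB deltaQ; field_simp; ring
  rw [mul_assoc, e3, e4]
  linarith

lemma reducedFeasible_corner : P.ReducedFeasible L D (P.alphaQ L D) (P.deltaQ L D) :=
  ⟨h.alphaQ_pos hL hD hDX, h.alphaQ_le_lamY hL hD hDX, h.deltaQ_pos hL hD hDX,
    (h.deltaQ_mul hL hD hDX).le, (h.line_eq hL hD hDX).le⟩

lemma upperRate_eq : P.upperRate L D = 1 / 2 * (Real.log (P.lamY L)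
    + ((L : ℝ) - 1) * Real.log P.gamY - P.payoff L (P.alphaQ L D) (P.deltaQ L D)) := by
  have hl := h.lamY_pos L
  have hq := h.lamQ_pos hL hD hDX
  have hg := h.gamY_pos
  have hd := h.deltaQ_pos hL hD hDX
  have ha := h.alphaQ_pos hL hD hDX
  have e : 1 + P.kappa L * P.alphaQ L D = P.alphaQ L D / P.deltaQ L D := by
    rw [eq_div_iff hd.ne', mul_comm]; exact h.deltaQ_mul hL hD hDX
  unfold upperRate payoff
  rw [e, Real.log_div ha.ne' hd.ne']
  have e1 : 1 + P.lamY L / P.lamQ L D = P.lamY L / P.alphaQ L D := by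
    unfold alphaQ; field_simp; ring
  have e2 : 1 + P.gamY / P.lamQ L D = P.gamY / P.deltaQ L D := by
    unfold deltaQ; field_simp; ring
  rw [e1, e2, Real.log_div hl.ne' ha.ne', Real.log_div hg.ne' hd.ne']
  ring

/-- The minimum of the program is attained and determines the gap. -/
lemma exists_gap_eq : IsLeast (P.feasibleValues L D) (P.lowerRate L D) ∧
    ∃ α δ : ℝ, P.ReducedFeasible L D α δ ∧
      (∀ x y : ℝ, P.ReducedFeasible L D x y → P.payoff L x y ≤ P.payoff L α δ) ∧
      P.gap L D = 1 / 2 * (P.payoff L α δ - P.payoff L (P.alphaQ L D) (P.deltaQ L D)) := by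
  have hc := h.reducedFeasible_corner hL hD hDX
  obtain ⟨α, δ, hf, hmax⟩ := exists_isMax_log_add_mul_log (h.kappa_nonneg L)
    (by positivity : (0 : ℝ) < L) hc.1 hc.2.1 hc.2.2.1 hc.2.2.2.1 hc.2.2.2.2
  have hleast : IsLeast (P.feasibleValues L D) (P.Omega L α δ δ) := by
    refine ⟨⟨α, δ, δ, h.feasible_of_reducedFeasible hL hf, rfl⟩, ?_⟩
    rintro r ⟨x, y, z, hxyz, rfl⟩
    obtain ⟨h1, h2, h3, h4, h5⟩ := h.reducedFeasible_of_feasible hL hxyz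
    have := hmax x z h1 h2 h3 h4 h5
    rw [h.Omega_eq h1 h3, h.Omega_eq hf.1 hf.2.2.1]
    unfold payoff
    linarith
  have hlow : P.lowerRate L D = P.Omega L α δ δ := hleast.csInf_eq
  refine ⟨hlow ▸ hleast, α, δ, hf, ?_, ?_⟩
  · rintro x y ⟨h1, h2, h3, h4, h5⟩
    exact hmax x y h1 h2 h3 h4 h5
  · unfold gap
    rw [hlow, h.upperRate_eq hL hD hDX, h.Omega_eq hf.1 hf.2.2.1]
    ring

lemma gap_nonneg : 0 ≤ P.gap L D := by
  obtain ⟨-, α, δ, -, hmax, e⟩ := h.exists_gap_eq hL hD hDX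
  have := hmax _ _ (h.reducedFeasible_corner hL hD hDX)
  rw [e]; linarith

/-- A sufficient condition for the two bounds to agree. -/
lemma gap_eq_zero (hmul : ((L : ℝ) - 1) * P.coefB *
      (P.deltaQ L D * (P.alphaQ L D - P.deltaQ L D)) ≤ L * P.coefA L * P.alphaQ L D ^ 2) :
    P.gap L D = 0 := by
  obtain ⟨-, α, δ, ⟨h1, -, h3, h4, h5⟩, -, e⟩ := h.exists_gap_eq hL hD hDX
  have hL1 : (1 : ℝ) ≤ L := by exact_mod_cast (by omega : 1 ≤ L)
  have := log_add_mul_log_le_of_corner (h.kappa_nonneg L) hL1 (h.coefA_pos hL) (coefB_nonneg P) h1 h3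
    (h.alphaQ_pos hL hD hDX) (h.deltaQ_pos hL hD hDX) h4 (h.deltaQ_mul hL hD hDX)
    (h5.trans (h.line_eq hL hD hDX).ge) hmul
  refine le_antisymm ?_ (h.gap_nonneg hL hD hDX)
  rw [e]; unfold payoff; linarith

/-- A bound on the gap by means of the maximum on the line. -/
lemma gap_le_line (hκ : 0 < P.kappa L) (hB : 0 < P.coefB) :
    P.gap L D ≤ 1 / 2 * (Real.log (P.lineTop L D) + L * Real.log (P.lineDelta L D)
      - P.payoff L (P.alphaQ L D) (P.deltaQ L D)) := by
  obtain ⟨-, α, δ, ⟨h1, -, h3, h4, h5⟩, -, e⟩ := h.exists_gap_eq hL hD hDX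
  have hL1 : (1 : ℝ) < L := by exact_mod_cast (by omega : 1 < L)
  have := log_add_mul_log_le_of_line hκ hL1 (h.coefA_pos hL) hB
    (mul_pos (by linarith) (sub_pos.2 hD)) h1 h3 h5
  rw [e]; unfold payoff lineTop lineDelta at *; linarith

/-- The gap when the maximizer on the line is feasible. -/
lemma line_le_gap (hκ : 0 < P.kappa L) (hB : 0 < P.coefB)
    (h1 : 1 < P.lineTop L D) (h2 : P.lineTop L D ≤ 1 + P.kappa L * P.lamY L)
    (h3 : P.lineDelta L D * P.lineTop L D ≤ (P.lineTop L D - 1) / P.kappa L) :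
    1 / 2 * (Real.log (P.lineTop L D) + L * Real.log (P.lineDelta L D)
      - P.payoff L (P.alphaQ L D) (P.deltaQ L D)) ≤ P.gap L D := by
  obtain ⟨-, α, δ, -, hmax, e⟩ := h.exists_gap_eq hL hD hDX
  have hL1 : (1 : ℝ) < L := by exact_mod_cast (by omega : 1 < L)
  have hA := h.coefA_pos hL
  have hm : 0 < D - P.dMin L := sub_pos.2 hD
  have hL2 : 0 < (L : ℝ) - 1 := by linarith
  have e1 : 1 + P.kappa L * ((P.lineTop L D - 1) / P.kappa L) = P.lineTop L D := by
    field_simp; ring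
  -- The candidate is the line maximizer; the three hypotheses give, in order, `0 < α`, `α ≤ λ_Y`
  -- and the first constraint.
  have := hmax ((P.lineTop L D - 1) / P.kappa L) (P.lineDelta L D) (by
    refine ⟨div_pos (by linarith) hκ, (div_le_iff₀ hκ).2 (by linarith), ?_, by rwa [e1], ?_⟩
    · unfold lineDelta; positivity
    · apply le_of_eq
      unfold lineDelta lineTop
      field_simp
      ring)
  rw [payoff, e1] at this
  rw [e]; linarith

end Admissible

/-! ### Limits of the parameters and the multiplier condition -/

namespace Admissible

variable (h : P.Admissible)
include h

omit h in
lemma dTh0_eq (hc : 0 < P.covY) :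
    P.dTh0 = P.varX - (P.rhoX * P.varX) ^ 2 / P.covY := by
  have e : P.rhoZ * P.varZ = P.covY - P.rhoX * P.varX := by unfold covY; ring
  have e' : P.rhoX * P.rhoZ * P.varX * P.varZ = P.rhoX * P.varX * (P.rhoZ * P.varZ) := by ring
  unfold dTh0 gamX
  rw [e', e]
  field_simp
  ring

lemma dTh0_sub_dMinInf (hc : 0 < P.covY) : P.dTh0 - P.dMinInf = P.gamX ^ 2 / P.gamY := by
  have hg := h.gamY_pos
  unfold dTh0 dMinInf
  rw [if_neg hc.ne', show P.gamZ = P.gamY - P.gamX by linarith [h.gamX_add_gamZ]]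
  field_simp
  ring

lemma dMin_eq_of_covY_eq_zero (hc : P.covY = 0) {L : ℕ} (hL : 2 ≤ L) :
    P.dMin L = P.dMinInf := by
  have e1 : P.rhoX * P.varX = 0 := by
    have := h.covX_nonneg; have := h.covZ_nonneg; unfold covY at hc; linarith
  have e2 : P.rhoZ * P.varZ = 0 := by
    have := h.covX_nonneg; have := h.covZ_nonneg; unfold covY at hc; linarith
  have e3 : P.gamY = P.varX + P.varZ := by rw [h.gamY_eq, hc, sub_zero]
  have hg := h.gamY_pos
  have hL0 : (L : ℝ) ≠ 0 := by positivity
  unfold dMin dMinInf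
  rw [if_pos hc, lamX_eq, lamZ_eq, h.lamY_eq, e1, e2, hc, ← e3]
  have e4 : P.gamX = P.varX := by unfold gamX; linarith
  have e5 : P.gamZ = P.varZ := by unfold gamZ; linarith
  rw [e4, e5]
  field_simp
  ring

omit h in
lemma tendsto_natCast_atTop : Tendsto (fun L : ℕ => (L : ℝ)) atTop atTop :=
  tendsto_natCast_atTop_atTop

lemma tendsto_lamY (hc : 0 < P.covY) : Tendsto P.lamY atTop atTop := by
  rw [show P.lamY = fun L : ℕ => P.gamY + L * P.covY from funext h.lamY_eq]
  exact tendsto_atTop_add_const_left _ _ (tendsto_natCast_atTop.atTop_mul_const hc)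

omit h in
lemma tendsto_affine_div (a b : ℝ) :
    Tendsto (fun L : ℕ => (a + L * b) / (L : ℝ)) atTop (𝓝 b) := by
  have t := (tendsto_const_div_atTop_nhds_zero_nat a).add_const b
  rw [zero_add] at t
  refine t.congr' ?_
  filter_upwards [eventually_gt_atTop 0] with L hL
  have : (0 : ℝ) < L := by exact_mod_cast hL
  field_simp

omit h in
lemma tendsto_sub_one_div : Tendsto (fun L : ℕ => ((L : ℝ) - 1) / (L : ℝ)) atTop (𝓝 1) := by
  refine (tendsto_affine_div (-1) 1).congr fun L => ?_
  ring

omit h in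
lemma tendsto_lamX_div : Tendsto (fun L : ℕ => P.lamX L / (L : ℝ)) atTop
    (𝓝 (P.rhoX * P.varX)) := by
  simp only [lamX_eq]; exact tendsto_affine_div _ _

omit h in
lemma tendsto_lamZ_div : Tendsto (fun L : ℕ => P.lamZ L / (L : ℝ)) atTop
    (𝓝 (P.rhoZ * P.varZ)) := by
  simp only [lamZ_eq]; exact tendsto_affine_div _ _

lemma tendsto_lamY_div : Tendsto (fun L : ℕ => P.lamY L / (L : ℝ)) atTop (𝓝 P.covY) := by
  simp only [h.lamY_eq]; exact tendsto_affine_div _ _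

lemma tendsto_dMin : Tendsto P.dMin atTop (𝓝 P.dMinInf) := by
  rcases h.covY_nonneg.eq_or_lt with hc | hc
  · refine tendsto_const_nhds.congr' ?_
    filter_upwards [eventually_ge_atTop 2] with L hL
    exact (h.dMin_eq_of_covY_eq_zero hc.symm hL).symm
  · have t := ((tendsto_lamX_div (P := P)).mul (tendsto_lamZ_div (P := P))).div
      h.tendsto_lamY_div hc.ne'
    have t2 := t.add (tendsto_sub_one_div.mul_const (P.gamX * P.gamZ / P.gamY))
    have e : P.rhoX * P.varX * (P.rhoZ * P.varZ) / P.covY + 1 * (P.gamX * P.gamZ / P.gamY)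
        = P.dMinInf := by
      unfold dMinInf; rw [if_neg hc.ne']; ring
    rw [e] at t2
    refine t2.congr' ?_
    filter_upwards [eventually_gt_atTop 0] with L hL
    have hL0 : (0 : ℝ) < L := by exact_mod_cast hL
    have hl := h.lamY_pos L
    have hg := h.gamY_pos
    unfold dMin
    simp only [Pi.div_apply]
    field_simp

lemma tendsto_coefA (hc : 0 < P.covY) :
    Tendsto P.coefA atTop (𝓝 ((P.rhoX * P.varX / P.covY) ^ 2)) := by
  refine (((tendsto_lamX_div (P := P)).div h.tendsto_lamY_div hc.ne').pow 2).congr' ?_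
  filter_upwards [eventually_gt_atTop 0] with L hL
  have hL0 : (0 : ℝ) < L := by exact_mod_cast hL
  have hl := h.lamY_pos L
  unfold coefA
  simp only [Pi.div_apply]
  field_simp

lemma tendsto_kappa (hc : 0 < P.covY) : Tendsto P.kappa atTop (𝓝 P.gamY⁻¹) := by
  have := (tendsto_inv_atTop_zero.comp (h.tendsto_lamY hc)).const_sub P.gamY⁻¹
  rwa [sub_zero] at this

lemma kappa_pos (hc : 0 < P.covY) {L : ℕ} (hL : 2 ≤ L) : 0 < P.kappa L := by
  have : P.gamY < P.lamY L := by
    rw [h.lamY_eq]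
    have : (0 : ℝ) < L := by exact_mod_cast (by omega : 0 < L)
    linarith [mul_pos this hc]
  exact sub_pos.2 (inv_strictAnti₀ h.gamY_pos this)

/-- After taking roots and clearing denominators, both sides are affine in `L`: `y ≤ 1` compares the
constant terms and `hyc` the slopes. The bound thus holds for every `L`, not only in the limit. -/
lemma sq_mul_coefB_le_coefA {y : ℝ} (hy : 0 ≤ y) (hy1 : y ≤ 1)
    (hyc : y * (P.gamX * P.covY) ≤ P.rhoX * P.varX * P.gamY) (L : ℕ) :
    y ^ 2 * P.coefB ≤ P.coefA L := by
  have hg := h.gamY_pos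
  have hl := h.lamY_pos L
  have hx := h.gamX_nonneg
  have key : y * P.gamX / P.gamY ≤ P.lamX L / P.lamY L := by
    rw [div_le_div_iff₀ hg hl, lamX_eq, h.lamY_eq]
    have := mul_le_mul_of_nonneg_left hyc (Nat.cast_nonneg (α := ℝ) L)
    have := mul_le_mul_of_nonneg_right hy1 (mul_nonneg hx hg.le)
    linarith
  have := pow_le_pow_left₀ (by positivity) key 2
  unfold coefA coefB
  calc y ^ 2 * (P.gamX ^ 2 / P.gamY ^ 2) = (y * P.gamX / P.gamY) ^ 2 := by ring
    _ ≤ _ := this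
    _ = _ := by rw [div_pow]

lemma gap_eq_zero_of_ratio_le {y : ℝ} {L : ℕ} (hL : 2 ≤ L) {D : ℝ} (hD : P.dMin L < D)
    (hDX : D < P.varX) (hy : y ^ 2 * P.coefB ≤ P.coefA L)
    (hr : P.deltaQ L D * (P.alphaQ L D - P.deltaQ L D) ≤ y ^ 2 * P.alphaQ L D ^ 2) :
    P.gap L D = 0 := by
  refine h.gap_eq_zero hL hD hDX ?_
  have hL1 : (1 : ℝ) ≤ L := by exact_mod_cast (by omega : 1 ≤ L)
  have hA := h.coefA_pos hL
  have hB := coefB_nonneg P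
  calc ((L : ℝ) - 1) * P.coefB * (P.deltaQ L D * (P.alphaQ L D - P.deltaQ L D))
      ≤ ((L : ℝ) - 1) * P.coefB * (y ^ 2 * P.alphaQ L D ^ 2) :=
        mul_le_mul_of_nonneg_left hr (mul_nonneg (by linarith) hB)
    _ = ((L : ℝ) - 1) * (y ^ 2 * P.coefB) * P.alphaQ L D ^ 2 := by ring
    _ ≤ ((L : ℝ) - 1) * P.coefA L * P.alphaQ L D ^ 2 := by
        have : 0 ≤ (L : ℝ) - 1 := by linarith
        gcongr
    _ ≤ (L : ℝ) * P.coefA L * P.alphaQ L D ^ 2 := by gcongr; linarith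

lemma gap_eq_zero_of_half (hyc : 1 / 2 * (P.gamX * P.covY) ≤ P.rhoX * P.varX * P.gamY)
    {L : ℕ} (hL : 2 ≤ L) {D : ℝ} (hD : P.dMin L < D) (hDX : D < P.varX) : P.gap L D = 0 := by
  refine h.gap_eq_zero_of_ratio_le hL hD hDX
    (h.sq_mul_coefB_le_coefA (y := 1 / 2) (by norm_num) (by norm_num) hyc L) ?_
  nlinarith [sq_nonneg (P.alphaQ L D - 2 * P.deltaQ L D)]

lemma xi_mul (hc : 0 < P.covY) (h1 : P.rhoX < 1) :
    P.xi * (P.gamX * P.covY) = P.rhoX * P.varX * P.gamY := by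
  have hv := h.varY_pos
  have : (1 - P.rhoX) ≠ 0 := by linarith
  unfold xi gamX gamY rhoY
  field_simp

/-! ### Asymptotics of the upper bound -/

variable {D : ℝ} (hD : P.dMinInf < D) (hDX : D < P.varX)

include hD in
lemma eventually_dMin_lt : ∀ᶠ L in atTop, P.dMin L < D := h.tendsto_dMin.eventually (gt_mem_nhds hD)

lemma tendsto_residual (hc : 0 < P.covY) {q : ℝ} (hq : 0 < q) :
    Tendsto (fun L : ℕ => (P.lamX L ^ 2 / (P.lamY L + q)
      + ((L : ℝ) - 1) * (P.gamX ^ 2 / (P.gamY + q))) / L) atTop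
      (𝓝 ((P.rhoX * P.varX) ^ 2 / P.covY + P.gamX ^ 2 / (P.gamY + q))) := by
  have t0 : Tendsto (fun L : ℕ => (P.lamY L + q) / L) atTop (𝓝 P.covY) := by
    have := h.tendsto_lamY_div.add (tendsto_const_div_atTop_nhds_zero_nat q)
    rw [add_zero] at this
    exact this.congr fun L => by ring
  have t := (((tendsto_lamX_div (P := P)).pow 2).div t0 hc.ne').add
    (tendsto_sub_one_div.mul_const (P.gamX ^ 2 / (P.gamY + q)))
  rw [one_mul] at t
  refine t.congr' ?_
  filter_upwards [eventually_gt_atTop 0] with L hL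
  have hL0 : (0 : ℝ) < L := by exact_mod_cast hL
  have hl := h.lamY_pos L
  have hg := h.gamY_pos
  simp only [Pi.div_apply]
  field_simp

include hD hDX

/-- Monotonicity of the residual turns a comparison with a fixed `q` into the sign of a limit: after
division by `L`, the limiting equation for `λ_Q` is `γ_X² / (γ_Y + q) = D_{th,0} - D`. -/
lemma eventually_lt_lamQ (hc : 0 < P.covY) {q : ℝ} (hq : 0 < q)
    (hlt : P.dTh0 - D < P.gamX ^ 2 / (P.gamY + q)) : ∀ᶠ L in atTop, q < P.lamQ L D := by
  have := (h.tendsto_residual hc hq).eventually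
    (lt_mem_nhds (by rw [dTh0_eq hc] at hlt; linarith : P.varX - D < _))
  filter_upwards [this, h.eventually_dMin_lt hD, eventually_ge_atTop 2] with L h1 h2 hL
  have hL0 : (0 : ℝ) < L := by positivity
  rw [lt_div_iff₀ hL0] at h1
  obtain ⟨p1, p2⟩ := isLamQ_iff.1 (h.isLamQ_lamQ hL h2 hDX)
  by_contra hcon
  rcases (not_lt.1 hcon).eq_or_lt with e | e
  · rw [e] at p2; linarith
  · have := h.residual_lt hL p1.le e
    linarith

lemma eventually_lamQ_lt (hc : 0 < P.covY) {q : ℝ} (hq : 0 < q)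
    (hlt : P.gamX ^ 2 / (P.gamY + q) < P.dTh0 - D) : ∀ᶠ L in atTop, P.lamQ L D < q := by
  have := (h.tendsto_residual hc hq).eventually
    (gt_mem_nhds (by rw [dTh0_eq hc] at hlt; linarith : _ < P.varX - D))
  filter_upwards [this, h.eventually_dMin_lt hD, eventually_ge_atTop 2] with L h1 h2 hL
  have hL0 : (0 : ℝ) < L := by positivity
  rw [div_lt_iff₀ hL0] at h1
  obtain ⟨p1, p2⟩ := isLamQ_iff.1 (h.isLamQ_lamQ hL h2 hDX)
  by_contra hcon
  rcases (not_lt.1 hcon).eq_or_lt with e | e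
  · rw [← e] at p2; linarith
  · have := h.residual_lt hL hq.le e
    linarith

lemma tendsto_lamQ_atTop (hc : 0 < P.covY) (hX : 0 < P.gamX) (hle : P.dTh0 ≤ D) :
    Tendsto (fun L => P.lamQ L D) atTop atTop := by
  refine tendsto_atTop.2 fun b => ?_
  have hg := h.gamY_pos
  have hb : 0 < max b 1 := lt_max_of_lt_right one_pos
  have p : 0 < P.gamX ^ 2 / (P.gamY + max b 1) := by positivity
  filter_upwards [h.eventually_lt_lamQ hD hDX hc hb (by linarith)] with L hL
  exact (le_max_left _ _).trans hL.le

omit hDX in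
lemma gamY_lt (hc : 0 < P.covY) (hlt : D < P.dTh0) :
    P.gamY < P.gamX ^ 2 / (P.dTh0 - D) := by
  have e := h.dTh0_sub_dMinInf hc
  have hg := h.gamY_pos
  rw [eq_div_iff hg.ne'] at e
  rw [lt_div_iff₀ (by linarith)]
  nlinarith

lemma tendsto_lamQ (hc : 0 < P.covY) (hlt : D < P.dTh0) :
    Tendsto (fun L => P.lamQ L D) atTop (𝓝 (P.gamX ^ 2 / (P.dTh0 - D) - P.gamY)) := by
  have hx : 0 < P.dTh0 - D := by linarith
  have hg := h.gamY_pos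
  have hqpos := h.gamY_lt hD hc hlt
  refine tendsto_order.2 ⟨fun a ha => ?_, fun a ha => ?_⟩
  · rcases le_or_gt a 0 with h0 | h0
    · filter_upwards [h.eventually_dMin_lt hD, eventually_ge_atTop 2] with L h2 hL
      exact h0.trans_lt (h.lamQ_pos hL h2 hDX)
    · refine h.eventually_lt_lamQ hD hDX hc h0 ?_
      rw [lt_sub_iff_add_lt, lt_div_iff₀ hx] at ha
      rw [lt_div_iff₀ (by positivity)]
      linarith
  · have h0 : 0 < a := by linarith
    refine h.eventually_lamQ_lt hD hDX hc h0 ?_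
    rw [gt_iff_lt, sub_lt_iff_lt_add, div_lt_iff₀ hx] at ha
    rw [div_lt_iff₀ (by positivity)]
    linarith

lemma tendsto_alphaQ (hc : 0 < P.covY) (hlt : D < P.dTh0) :
    Tendsto (fun L => P.alphaQ L D) atTop (𝓝 (P.gamX ^ 2 / (P.dTh0 - D) - P.gamY)) := by
  have t := h.tendsto_lamQ hD hDX hc hlt
  have t1 : Tendsto (fun L => 1 + P.lamQ L D / P.lamY L) atTop (𝓝 (1 + 0)) :=
    (t.div_atTop (h.tendsto_lamY hc)).const_add 1
  rw [add_zero] at t1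
  have t2 := t.div t1 one_ne_zero
  rw [div_one] at t2
  refine t2.congr fun L => ?_
  have hl := h.lamY_pos L
  unfold alphaQ
  simp only [Pi.div_apply]
  rw [show 1 + P.lamQ L D / P.lamY L = (P.lamY L + P.lamQ L D) / P.lamY L by field_simp,
    div_div_eq_mul_div, mul_comm]

lemma tendsto_deltaQ (hc : 0 < P.covY) (hX : 0 < P.gamX) (hlt : D < P.dTh0) :
    Tendsto (fun L => P.deltaQ L D) atTop (𝓝 ((D - P.dMinInf) / P.coefB)) := by
  have t := h.tendsto_lamQ hD hDX hc hlt
  have hx : 0 < P.dTh0 - D := by linarith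
  have hg := h.gamY_pos
  have e : P.gamY + (P.gamX ^ 2 / (P.dTh0 - D) - P.gamY) = P.gamX ^ 2 / (P.dTh0 - D) := by ring
  have t1 := (t.const_mul P.gamY).div (t.const_add P.gamY) (by rw [e]; positivity)
  have e2 : P.gamY * (P.gamX ^ 2 / (P.dTh0 - D) - P.gamY)
      / (P.gamY + (P.gamX ^ 2 / (P.dTh0 - D) - P.gamY)) = (D - P.dMinInf) / P.coefB := by
    have := h.dTh0_sub_dMinInf hc
    rw [e, show D - P.dMinInf = P.gamX ^ 2 / P.gamY - (P.dTh0 - D) by linarith]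
    unfold coefB
    field_simp
  rw [e2] at t1
  exact t1

omit hD hDX in
lemma tendsto_lineTop (hc : 0 < P.covY) (hr : 0 < P.rhoX * P.varX) :
    Tendsto (fun L => P.lineTop L D) atTop
      (𝓝 ((D - P.dMinInf) / (P.gamY * (P.rhoX * P.varX / P.covY) ^ 2))) := by
  have hg := h.gamY_pos
  have hA := h.tendsto_coefA hc
  have t1 : Tendsto (fun L => P.kappa L * (D - P.dMin L) + P.coefA L / (L : ℝ)) atTop
      (𝓝 (P.gamY⁻¹ * (D - P.dMinInf) + 0)) :=
    ((h.tendsto_kappa hc).mul (h.tendsto_dMin.const_sub D)).add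
      (hA.div_atTop tendsto_natCast_atTop)
  have t2 := t1.div ((tendsto_affine_div 1 1).mul hA) (by positivity)
  have e : (P.gamY⁻¹ * (D - P.dMinInf) + 0) / (1 * (P.rhoX * P.varX / P.covY) ^ 2)
      = (D - P.dMinInf) / (P.gamY * (P.rhoX * P.varX / P.covY) ^ 2) := by
    field_simp
    ring
  rw [e] at t2
  refine t2.congr' ?_
  filter_upwards [eventually_ge_atTop 2] with L hL
  have hL0 : (0 : ℝ) < L := by positivity
  have := h.coefA_pos hL
  unfold lineTop
  simp only [Pi.div_apply]
  field_simp
  ring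

omit hD hDX in
lemma tendsto_lineDelta (hc : 0 < P.covY) (hX : 0 < P.gamX) :
    Tendsto (fun L => P.lineDelta L D) atTop (𝓝 ((D - P.dMinInf) / P.coefB)) := by
  have hg := h.gamY_pos
  have hB : 0 < P.coefB := by unfold coefB; positivity
  have t1 : Tendsto (fun L => D - P.dMin L + P.coefA L / P.kappa L / (L : ℝ)) atTop
      (𝓝 (D - P.dMinInf + 0)) :=
    (h.tendsto_dMin.const_sub D).add
      (((h.tendsto_coefA hc).div (h.tendsto_kappa hc) (by positivity)).div_atTop
        tendsto_natCast_atTop)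
  have t2 := t1.div (((tendsto_affine_div 1 1).mul tendsto_sub_one_div).mul_const P.coefB)
    (by positivity)
  rw [add_zero, one_mul, one_mul] at t2
  refine t2.congr' ?_
  filter_upwards [eventually_ge_atTop 2] with L hL
  have hL0 : (0 : ℝ) < L := by positivity
  have hk := h.kappa_pos hc hL
  have hL1 : (0 : ℝ) < L - 1 := by
    have : (2 : ℝ) ≤ L := by exact_mod_cast hL
    linarith
  unfold lineDelta
  simp only [Pi.div_apply]
  field_simp
  ring

/-- The excess of the payoff at the maximizer on the line over the payoff of the upper bound. -/
lemma tendsto_line_sub_payoff (hc : 0 < P.covY) (hr : 0 < P.rhoX * P.varX) (hX : 0 < P.gamX)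
    (hlt : D < P.dTh0) :
    Tendsto (fun L : ℕ => Real.log (P.lineTop L D) + L * Real.log (P.lineDelta L D)
      - P.payoff L (P.alphaQ L D) (P.deltaQ L D)) atTop
      (𝓝 (Real.log ((D - P.dMinInf) * (P.dTh0 - D) / (P.rhoX * P.varX * P.gamX / P.covY) ^ 2)
        + ((P.rhoX * P.varX * P.gamX / P.covY) ^ 2 / ((D - P.dMinInf) * (P.dTh0 - D)) - 1))) := by
  have hx : 0 < P.dTh0 - D := by linarith
  have hm : 0 < D - P.dMinInf := by linarith
  have hg := h.gamY_pos
  have hB : 0 < P.coefB := by unfold coefB; positivity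
  have hA := h.tendsto_coefA hc
  have hα := h.tendsto_alphaQ hD hDX hc hlt
  have hT := h.tendsto_lineTop (D := D) hc hr
  have hκ := h.tendsto_kappa hc
  have t1 : Tendsto (fun L => Real.log (P.lineTop L D / (1 + P.kappa L * P.alphaQ L D))) atTop
      (𝓝 (Real.log ((D - P.dMinInf) * (P.dTh0 - D)
        / (P.rhoX * P.varX * P.gamX / P.covY) ^ 2))) := by
    have e0 : 1 + P.gamY⁻¹ * (P.gamX ^ 2 / (P.dTh0 - D) - P.gamY)
        = P.gamX ^ 2 / (P.gamY * (P.dTh0 - D)) := by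
      field_simp; ring
    have t := hT.div ((hκ.mul hα).const_add 1) (by rw [e0]; positivity)
    have e : (D - P.dMinInf) / (P.gamY * (P.rhoX * P.varX / P.covY) ^ 2)
        / (1 + P.gamY⁻¹ * (P.gamX ^ 2 / (P.dTh0 - D) - P.gamY))
        = (D - P.dMinInf) * (P.dTh0 - D) / (P.rhoX * P.varX * P.gamX / P.covY) ^ 2 := by
      have hrX : P.rhoX ≠ 0 := left_ne_zero_of_mul hr.ne'
      have hvX := h.varX_pos.ne'
      rw [e0]
      field_simp
    rw [e] at t
    exact t.log (by positivity)
  -- Both values of `δ` have the same limit, so the factor `L` calls for their first-order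
  -- difference. Solving the active line constraint for `δ_Q` makes `L (δ_line / δ_Q - 1)` an
  -- explicit quotient with convergent terms.
  have t2 : Tendsto (fun L : ℕ => (L : ℝ) * Real.log (1 + (P.lineDelta L D / P.deltaQ L D - 1)))
      atTop (𝓝 ((P.rhoX * P.varX * P.gamX / P.covY) ^ 2
        / ((D - P.dMinInf) * (P.dTh0 - D)) - 1)) := by
    apply Real.tendsto_nat_mul_log_one_add_of_tendsto
    have hM := h.tendsto_dMin.const_sub D
    have u1 := ((hA.div hκ (by positivity)).sub hM).add
      ((tendsto_affine_div 1 1).mul (hA.mul hα))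
    have u2 := (tendsto_affine_div 1 1).mul
      (hM.sub ((hA.mul hα).div_atTop tendsto_natCast_atTop))
    have u3 := u1.div u2 (by rw [sub_zero, one_mul]; exact hm.ne')
    have e : ((P.rhoX * P.varX / P.covY) ^ 2 / P.gamY⁻¹ - (D - P.dMinInf)
        + 1 * ((P.rhoX * P.varX / P.covY) ^ 2 * (P.gamX ^ 2 / (P.dTh0 - D) - P.gamY)))
        / (1 * (D - P.dMinInf - 0))
        = (P.rhoX * P.varX * P.gamX / P.covY) ^ 2 / ((D - P.dMinInf) * (P.dTh0 - D)) - 1 := by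
      rw [sub_zero]
      field_simp
      ring
    rw [e] at u3
    refine u3.congr' ?_
    filter_upwards [eventually_ge_atTop 2, h.eventually_dMin_lt hD] with L hL hDL
    have hL0 : (0 : ℝ) < L := by positivity
    have hk := h.kappa_pos hc hL
    have hL1 : (0 : ℝ) < L - 1 := by
      have : (2 : ℝ) ≤ L := by exact_mod_cast hL
      linarith
    have hline := h.line_eq hL hDL hDX
    have hd := h.deltaQ_pos hL hDL hDX
    have e1 : P.deltaQ L D = (L * (D - P.dMin L) - P.coefA L * P.alphaQ L D)
        / ((L - 1) * P.coefB) := by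
      rw [eq_div_iff (by positivity)]; linarith
    have hN : 0 < L * (D - P.dMin L) - P.coefA L * P.alphaQ L D := by
      rw [e1] at hd
      exact (div_pos_iff_of_pos_right (by positivity)).1 hd
    have e2 : D - P.dMin L - P.coefA L * P.alphaQ L D / L
        = (L * (D - P.dMin L) - P.coefA L * P.alphaQ L D) / L := by field_simp
    rw [e1]
    unfold lineDelta
    simp only [Pi.div_apply]
    rw [e2]
    generalize hNe : (L : ℝ) * (D - P.dMin L) - P.coefA L * P.alphaQ L D = N at *
    have : D - P.dMin L = (N + P.coefA L * P.alphaQ L D) / L := by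
      rw [← hNe]; field_simp; ring
    rw [this]
    field_simp
    ring
  refine (t1.add t2).congr' ?_
  have hTpos : ∀ᶠ L in atTop, 0 < P.lineTop L D := hT.eventually (lt_mem_nhds (by positivity))
  have hdpos : ∀ᶠ L in atTop, 0 < P.lineDelta L D :=
    (h.tendsto_lineDelta hc hX).eventually (lt_mem_nhds (by positivity))
  filter_upwards [eventually_ge_atTop 2, h.eventually_dMin_lt hD, hTpos, hdpos]
    with L hL hDL p1 p2
  have hk := h.kappa_pos hc hL
  have hd := h.deltaQ_pos hL hDL hDX
  have ha := h.alphaQ_pos hL hDL hDX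
  have p3 : 0 < 1 + P.kappa L * P.alphaQ L D := by positivity
  rw [add_sub_cancel, Real.log_div p1.ne' p3.ne', Real.log_div p2.ne' hd.ne']
  unfold payoff
  ring

end Admissible

/-! ### The thresholds and the limit of the gap -/

namespace Admissible

variable (h : P.Admissible) {D : ℝ} (hD : P.dMinInf < D) (hDX : D < P.varX)
include h

lemma xi_mul_sq_div (hc : 0 < P.covY) (h1 : P.rhoX < 1) :
    P.rhoX * P.varX * P.gamX / P.covY = P.xi * (P.gamX ^ 2 / P.gamY) := by
  have hg := h.gamY_pos
  have := h.xi_mul hc h1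
  rw [div_eq_iff hc.ne', eq_comm, mul_div_assoc', div_mul_eq_mul_div, div_eq_iff hg.ne']
  linear_combination P.gamX * this

/-- The two thresholds are the roots of a quadratic polynomial. -/
lemma dTh_mul (hc : 0 < P.covY) (h0 : 0 ≤ P.xi) (h1 : P.rhoX < 1) (hxi : P.xi < 1 / 2) (D : ℝ) :
    (P.dTh1 - D) * (P.dTh2 - D)
      = (P.rhoX * P.varX * P.gamX / P.covY) ^ 2 - (D - P.dMinInf) * (P.dTh0 - D) := by
  have hg := h.gamY_pos
  have hs : Real.sqrt (1 - 4 * P.xi ^ 2) ^ 2 = 1 - 4 * P.xi ^ 2 :=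
    Real.sq_sqrt (by nlinarith)
  have e1 : P.dTh1 = P.dTh0
      - (1 + Real.sqrt (1 - 4 * P.xi ^ 2)) / 2 * (P.gamX ^ 2 / P.gamY) := rfl
  have e2 : P.dTh2 = P.dTh0
      - (1 - Real.sqrt (1 - 4 * P.xi ^ 2)) / 2 * (P.gamX ^ 2 / P.gamY) := rfl
  have e3 : P.dMinInf = P.dTh0 - P.gamX ^ 2 / P.gamY := by linarith [h.dTh0_sub_dMinInf hc]
  have e4 := h.xi_mul_sq_div hc h1
  rw [e4, e1, e2, e3]
  generalize P.gamX ^ 2 / P.gamY = G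
  generalize Real.sqrt (1 - 4 * P.xi ^ 2) = s at *
  linear_combination -(G ^ 2 / 4) * hs

lemma dTh2_le_dTh0 : P.dTh2 ≤ P.dTh0 := by
  have hg := h.gamY_pos
  have e2 : P.dTh2 = P.dTh0
      - (1 - Real.sqrt (1 - 4 * P.xi ^ 2)) / 2 * (P.gamX ^ 2 / P.gamY) := rfl
  have : Real.sqrt (1 - 4 * P.xi ^ 2) ≤ 1 := Real.sqrt_le_one.2 (by nlinarith [sq_nonneg P.xi])
  have : 0 ≤ (1 - Real.sqrt (1 - 4 * P.xi ^ 2)) / 2 * (P.gamX ^ 2 / P.gamY) :=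
    mul_nonneg (by linarith) (by positivity)
  linarith

lemma dTh1_le_dTh2 : P.dTh1 ≤ P.dTh2 := by
  have hg := h.gamY_pos
  unfold dTh1 dTh2
  have := Real.sqrt_nonneg (1 - 4 * P.xi ^ 2)
  gcongr
  linarith

lemma xi_pos (hc : 0 < P.covY) (hr : 0 < P.rhoX * P.varX) (h1 : P.rhoX < 1)
    (hX : 0 < P.gamX) : 0 < P.xi := by
  have e := h.xi_mul hc h1
  have : 0 < P.xi * (P.gamX * P.covY) := by rw [e]; exact mul_pos hr h.gamY_pos
  exact (pos_iff_pos_of_mul_pos this).2 (by positivity)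

include hD hDX

/-- For distortions above `D_{th,0}` the two bounds eventually agree. -/
lemma eventually_gap_eq_zero_of_dTh0_le (hc : 0 < P.covY) (hr : 0 < P.rhoX * P.varX)
    (h1 : P.rhoX < 1) (hX : 0 < P.gamX) (hxi : P.xi < 1 / 2) (hle : P.dTh0 ≤ D) :
    ∀ᶠ L in atTop, P.gap L D = 0 := by
  have hξ := h.xi_pos hc hr h1 hX
  -- The sum is `γ_Y / α_Q`, which bounds `δ_Q / α_Q`. Here `λ_Q` is unbounded, so this ratio drops
  -- below `ξ²`.
  have t : Tendsto (fun L => P.gamY / P.lamQ L D + P.gamY / P.lamY L) atTop (𝓝 (0 + 0)) :=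
    (tendsto_const_nhds.div_atTop (h.tendsto_lamQ_atTop hD hDX hc hX hle)).add
      (tendsto_const_nhds.div_atTop (h.tendsto_lamY hc))
  have ht := t.eventually (gt_mem_nhds (by simpa using pow_pos hξ 2 : (0 : ℝ) + 0 < P.xi ^ 2))
  filter_upwards [ht, h.eventually_dMin_lt hD, eventually_ge_atTop 2] with L hL1 hDL hL
  refine h.gap_eq_zero_of_ratio_le hL hDL hDX
    (h.sq_mul_coefB_le_coefA hξ.le (by linarith) (h.xi_mul hc h1).le L) ?_
  have hl := h.lamY_pos L
  have hq := h.lamQ_pos hL hDL hDX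
  have hd := h.deltaQ_pos hL hDL hDX
  have ha := h.alphaQ_pos hL hDL hDX
  have hdg := h.le_gamY_of_reducedFeasible (h.reducedFeasible_corner hL hDL hDX)
  have e : (P.gamY / P.lamQ L D + P.gamY / P.lamY L) * P.alphaQ L D = P.gamY := by
    unfold alphaQ; field_simp
  have hda : P.deltaQ L D ≤ P.xi ^ 2 * P.alphaQ L D := by
    have := mul_le_mul_of_nonneg_right hL1.le ha.le
    linarith
  calc P.deltaQ L D * (P.alphaQ L D - P.deltaQ L D) ≤ P.deltaQ L D * P.alphaQ L D := by
        gcongr; linarith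
    _ ≤ P.xi ^ 2 * P.alphaQ L D * P.alphaQ L D := by gcongr
    _ = P.xi ^ 2 * P.alphaQ L D ^ 2 := by ring

/-- Away from the thresholds the two bounds eventually agree if `D` is outside of the interval. -/
lemma eventually_gap_eq_zero_of_lt (hc : 0 < P.covY) (hr : 0 < P.rhoX * P.varX)
    (h1 : P.rhoX < 1) (hX : 0 < P.gamX) (hxi : P.xi < 1 / 2) (hlt : D < P.dTh0)
    (hw : (D - P.dMinInf) * (P.dTh0 - D) < (P.rhoX * P.varX * P.gamX / P.covY) ^ 2) :
    ∀ᶠ L in atTop, P.gap L D = 0 := by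
  have hξ := h.xi_pos hc hr h1 hX
  have hg := h.gamY_pos
  have hx : 0 < P.dTh0 - D := by linarith
  have hα := h.tendsto_alphaQ hD hDX hc hlt
  have hδ := h.tendsto_deltaQ hD hDX hc hX hlt
  have e3 : D - P.dMinInf = P.gamX ^ 2 / P.gamY - (P.dTh0 - D) := by
    linarith [h.dTh0_sub_dMinInf hc]
  have e4 := h.xi_mul_sq_div hc h1
  -- The limiting form of `δ (α - δ) < ξ² α²`; up to a common positive factor it is `hw`.
  have hlim : (D - P.dMinInf) / P.coefB * (P.gamX ^ 2 / (P.dTh0 - D) - P.gamY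
      - (D - P.dMinInf) / P.coefB) < P.xi ^ 2 * (P.gamX ^ 2 / (P.dTh0 - D) - P.gamY) ^ 2 := by
    have hm : 0 < D - P.dMinInf := by linarith
    have e5 : P.gamX ^ 2 / (P.dTh0 - D) - P.gamY
        = (D - P.dMinInf) * P.gamY / (P.dTh0 - D) := by
      rw [e3]; field_simp
    have e6 : (D - P.dMinInf) * P.gamY / (P.dTh0 - D) - (D - P.dMinInf) / P.coefB
        = (D - P.dMinInf) ^ 2 * P.gamY ^ 2 / (P.gamX ^ 2 * (P.dTh0 - D)) := by
      unfold coefB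
      rw [e3]; field_simp
    rw [e4] at hw
    rw [e5, e6]
    unfold coefB
    have key : ∀ m x g G k : ℝ, 0 < m → 0 < x → 0 < g → 0 < G → m * x < (k * (G ^ 2 / g)) ^ 2 →
        m / (G ^ 2 / g ^ 2) * (m ^ 2 * g ^ 2 / (G ^ 2 * x)) < k ^ 2 * (m * g / x) ^ 2 := by
      intro m x g G k hm hx hg hG hlt
      have e : m / (G ^ 2 / g ^ 2) * (m ^ 2 * g ^ 2 / (G ^ 2 * x))
          = m * x * (m * g ^ 2 / (G ^ 2 * x)) ^ 2 := by field_simp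
      have e' : k ^ 2 * (m * g / x) ^ 2
          = (k * (G ^ 2 / g)) ^ 2 * (m * g ^ 2 / (G ^ 2 * x)) ^ 2 := by field_simp
      rw [e, e']
      exact mul_lt_mul_of_pos_right hlt (by positivity)
    exact key _ _ _ _ _ hm hx hg hX hw
  have ht := (hδ.mul (hα.sub hδ)).eventually_lt ((hα.pow 2).const_mul (P.xi ^ 2)) hlim
  filter_upwards [ht, h.eventually_dMin_lt hD, eventually_ge_atTop 2] with L hL1 hDL hL
  exact h.gap_eq_zero_of_ratio_le hL hDL hDX
    (h.sq_mul_coefB_le_coefA hξ.le (by linarith) (h.xi_mul hc h1).le L) hL1.le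

lemma tendsto_gap_zero (hc : 0 < P.covY) (hr : 0 < P.rhoX * P.varX)
    (h1 : P.rhoX < 1) (hX : 0 < P.gamX) (hxi : P.xi < 1 / 2) (hout : D ≤ P.dTh1 ∨ P.dTh2 ≤ D) :
    Tendsto (fun L : ℕ => P.gap L D) atTop (𝓝 0) := by
  have hξ := h.xi_pos hc hr h1 hX
  have of_eventually : (∀ᶠ L in atTop, P.gap L D = 0) →
      Tendsto (fun L : ℕ => P.gap L D) atTop (𝓝 0) := fun he =>
    tendsto_const_nhds.congr' (he.mono fun L hL => hL.symm)
  rcases le_or_gt P.dTh0 D with hle | hlt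
  · exact of_eventually (h.eventually_gap_eq_zero_of_dTh0_le hD hDX hc hr h1 hX hxi hle)
  have hprod : 0 ≤ (P.dTh1 - D) * (P.dTh2 - D) := by
    have := h.dTh1_le_dTh2
    rcases hout with h' | h'
    · exact mul_nonneg (by linarith) (by linarith)
    · exact mul_nonneg_of_nonpos_of_nonpos (by linarith) (by linarith)
  rw [h.dTh_mul hc hξ.le h1 hxi] at hprod
  -- At a threshold the limit does not decide the sign of the multiplier. The gap is squeezed
  -- instead between `0` and the line bound, whose limit is `(log 1 + 1 - 1) / 2`.
  rcases (sub_nonneg.1 hprod).eq_or_lt with e | hw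
  · have t := (h.tendsto_line_sub_payoff hD hDX hc hr hX hlt).const_mul (1 / 2)
    have hp : (D - P.dMinInf) * (P.dTh0 - D) ≠ 0 :=
      mul_ne_zero (by linarith) (by linarith)
    rw [← e, div_self hp, Real.log_one, sub_self, add_zero, mul_zero] at t
    have hB : 0 < P.coefB := by have := h.gamY_pos; unfold coefB; positivity
    refine tendsto_of_tendsto_of_tendsto_of_le_of_le' tendsto_const_nhds t ?_ ?_
    · filter_upwards [h.eventually_dMin_lt hD, eventually_ge_atTop 2] with L hDL hL
      exact h.gap_nonneg hL hDL hDX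
    · filter_upwards [h.eventually_dMin_lt hD, eventually_ge_atTop 2] with L hDL hL
      exact h.gap_le_line hL hDL hDX (h.kappa_pos hc hL) hB
  · exact of_eventually (h.eventually_gap_eq_zero_of_lt hD hDX hc hr h1 hX hxi hlt hw)

lemma tendsto_gap_deltaInf (hc : 0 < P.covY) (hr : 0 < P.rhoX * P.varX)
    (h1 : P.rhoX < 1) (hX : 0 < P.gamX) (hxi : P.xi < 1 / 2) (hD1 : P.dTh1 < D)
    (hD2 : D < P.dTh2) : Tendsto (fun L : ℕ => P.gap L D) atTop (𝓝 (P.deltaInf D)) := by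
  have hξ := h.xi_pos hc hr h1 hX
  have hg := h.gamY_pos
  have hB : 0 < P.coefB := by unfold coefB; positivity
  have hlt : D < P.dTh0 := hD2.trans_le h.dTh2_le_dTh0
  have hx : 0 < P.dTh0 - D := by linarith
  have hm : 0 < D - P.dMinInf := by linarith
  have hprod : (P.dTh1 - D) * (P.dTh2 - D) < 0 :=
    mul_neg_of_neg_of_pos (by linarith) (by linarith)
  have hmul := h.dTh_mul hc hξ.le h1 hxi D
  have e3 : P.dTh0 - D = P.gamX ^ 2 / P.gamY - (D - P.dMinInf) := by
    linarith [h.dTh0_sub_dMinInf hc]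
  have e4 := h.xi_mul_sq_div hc h1
  have hT := h.tendsto_lineTop (D := D) hc hr
  have hΔ := h.tendsto_lineDelta (D := D) hc hX
  have hκ := h.tendsto_kappa hc
  set T := (D - P.dMinInf) / (P.gamY * (P.rhoX * P.varX / P.covY) ^ 2) with hTdef
  have hTpos : 0 < T := by positivity
  -- Being strictly between the thresholds means `T x > 1`, where `x = 1 - u < 1` is the limit of
  -- `δ_Q / α_Q`. This yields both `T > 1` and the limiting strict form `u T < T - 1` of the first
  -- constraint.
  have hTx : 1 < T * ((P.dTh0 - D) / (P.gamX ^ 2 / P.gamY)) := by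
    have e : T * ((P.dTh0 - D) / (P.gamX ^ 2 / P.gamY))
        = (D - P.dMinInf) * (P.dTh0 - D) / (P.rhoX * P.varX * P.gamX / P.covY) ^ 2 := by
      have hrX : P.rhoX ≠ 0 := left_ne_zero_of_mul hr.ne'
      have hvX := h.varX_pos.ne'
      rw [hTdef]; field_simp
    rw [e, one_lt_div (by positivity)]
    linarith
  have eu : (P.dTh0 - D) / (P.gamX ^ 2 / P.gamY)
      = 1 - (D - P.dMinInf) / (P.gamX ^ 2 / P.gamY) := by
    rw [e3, sub_div, div_self (by positivity)]
  have hu : 0 < (D - P.dMinInf) / (P.gamX ^ 2 / P.gamY) := by positivity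
  rw [eu] at hTx
  have hT1 : 1 < T := by nlinarith
  have c1 := hT.eventually (lt_mem_nhds hT1)
  have c2 : ∀ᶠ L in atTop, P.lineTop L D ≤ P.lamY L / P.gamY := by
    filter_upwards [hT.eventually (gt_mem_nhds (lt_add_one T)),
      ((h.tendsto_lamY hc).atTop_div_const hg).eventually_ge_atTop (T + 1)] with L a b
    linarith
  have c3 := (hΔ.mul hT).eventually_lt ((hT.sub_const 1).div hκ (by positivity)) (by
    have : (D - P.dMinInf) / P.coefB
        = P.gamY * ((D - P.dMinInf) / (P.gamX ^ 2 / P.gamY)) := by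
      unfold coefB; field_simp
    rw [this, div_inv_eq_mul]
    nlinarith)
  have t := (h.tendsto_line_sub_payoff hD hDX hc hr hX hlt).const_mul (1 / 2)
  have elim : 1 / 2 * (Real.log ((D - P.dMinInf) * (P.dTh0 - D)
        / (P.rhoX * P.varX * P.gamX / P.covY) ^ 2)
        + ((P.rhoX * P.varX * P.gamX / P.covY) ^ 2 / ((D - P.dMinInf) * (P.dTh0 - D)) - 1))
      = P.deltaInf D := by
    unfold deltaInf
    rw [hmul, e4]
    have e5 : P.gamY ^ 2 / (P.xi ^ 2 * P.gamX ^ 4) * ((P.dTh0 - D) * (D - P.dMinInf))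
        = (D - P.dMinInf) * (P.dTh0 - D) / (P.xi * (P.gamX ^ 2 / P.gamY)) ^ 2 := by
      field_simp
    rw [e5]
    generalize P.xi * (P.gamX ^ 2 / P.gamY) = w
    field_simp
    ring
  rw [elim] at t
  refine t.congr' ?_
  filter_upwards [c1, c2, c3, h.eventually_dMin_lt hD, eventually_ge_atTop 2]
    with L c1 c2 c3 hDL hL
  have hk := h.kappa_pos hc hL
  refine le_antisymm (h.line_le_gap hL hDL hDX hk hB c1 ?_ c3.le) (h.gap_le_line hL hDL hDX hk hB)
  rw [← h.gamY_mul L, mul_div_cancel_left₀ _ hg.ne'] at c2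
  exact c2

/-- The logarithmic bound on the gap for uncorrelated sources. -/
lemma gap_isBigO_log (hc : 0 < P.covY) (hr : P.rhoX = 0) :
    (fun L : ℕ => P.gap L D) =O[atTop] (fun L : ℕ => Real.log (L : ℝ)) := by
  have hg := h.gamY_pos
  have hvX := h.varX_pos
  have hm : 0 < D - P.dMinInf := by linarith
  have hX : P.gamX = P.varX := by unfold gamX; rw [hr]; ring
  have hB : 0 < P.coefB := by unfold coefB; rw [hX]; positivity
  set K := P.varX ^ 2 / P.gamY with hK
  set C := 2 * (K / ((D - P.dMinInf) / 2)) with hC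
  have hm2 : ∀ᶠ L in atTop, (D - P.dMinInf) / 2 < D - P.dMin L :=
    (h.tendsto_dMin.const_sub D).eventually (lt_mem_nhds (by linarith))
  have hL2 : ∀ᶠ L : ℕ in atTop, K ≤ (L : ℝ) * ((D - P.dMinInf) / 4) :=
    (tendsto_natCast_atTop.atTop_mul_const (by linarith)).eventually_ge_atTop K
  -- The factor `1/2` in the gap leaves room for one more `log L`, which absorbs all constants, so
  -- the bound holds with constant `1`.
  have hlog : ∀ᶠ L : ℕ in atTop,
      Real.log (P.gamY + P.covY) - Real.log P.gamY + C ≤ Real.log (L : ℝ) :=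
    (Real.tendsto_log_atTop.comp tendsto_natCast_atTop).eventually_ge_atTop _
  refine IsBigO.of_bound 1 ?_
  filter_upwards [hm2, hL2, hlog, h.eventually_dMin_lt hD, eventually_ge_atTop 2]
    with L hm2 hL2 hlog hDL hL
  have hL1 : (2 : ℝ) ≤ L := by exact_mod_cast hL
  have hl := h.lamY_pos L
  have hk := h.kappa_nonneg L
  have hd := h.deltaQ_pos hL hDL hDX
  have ha := h.alphaQ_pos hL hDL hDX
  have hA := h.coefA_pos hL
  have hline := h.line_eq hL hDL hDX
  obtain ⟨-, α, δ, ⟨f1, f2, f3, -, f5⟩, -, e⟩ := h.exists_gap_eq hL hDL hDX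
  have hgap := h.gap_nonneg hL hDL hDX
  -- For `ρ_X = 0` the eigenvalue `λ_X = σ_X²` does not grow, hence `A λ_Y = σ_X⁴ / λ_Y` is bounded.
  have hAα : P.coefA L * P.alphaQ L D ≤ K := by
    calc P.coefA L * P.alphaQ L D ≤ P.coefA L * P.lamY L := by
          gcongr; exact h.alphaQ_le_lamY hL hDL hDX
      _ = P.varX ^ 2 / P.lamY L := by
          unfold coefA
          rw [lamX_eq, hr, hX]; field_simp; ring
      _ ≤ K := by rw [hK]; gcongr; exact h.gamY_le_lamY L
  have hhalf : (L : ℝ) * ((D - P.dMinInf) / 4) ≤ ((L : ℝ) - 1) * P.coefB * P.deltaQ L D := by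
    have : (L : ℝ) * ((D - P.dMinInf) / 2) ≤ L * (D - P.dMin L) := by gcongr
    linarith
  -- The corner exhausts the distortion budget with at most `K` spent on `α_Q`, so no feasible `δ`
  -- can exceed `δ_Q` by more than `K / ((L - 1) B)`.
  have hdiff : ((L : ℝ) - 1) * P.coefB * (δ - P.deltaQ L D) ≤ K := by
    have := mul_pos hA f1
    linarith
  have hn : 0 < ((L : ℝ) - 1) * P.coefB := mul_pos (by linarith) hB
  have hratio : (L : ℝ) * ((δ - P.deltaQ L D) / P.deltaQ L D) ≤ C := by
    have e1 : (L : ℝ) * ((δ - P.deltaQ L D) / P.deltaQ L D)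
        = (L : ℝ) * (((L : ℝ) - 1) * P.coefB * (δ - P.deltaQ L D))
          / (((L : ℝ) - 1) * P.coefB * P.deltaQ L D) := by
      rw [← mul_div_assoc]
      have := hn.ne'
      generalize ((L : ℝ) - 1) * P.coefB = n at *
      field_simp
    have hK0 : 0 ≤ K := by positivity
    rw [e1]
    calc (L : ℝ) * (((L : ℝ) - 1) * P.coefB * (δ - P.deltaQ L D))
          / (((L : ℝ) - 1) * P.coefB * P.deltaQ L D)
        ≤ (L : ℝ) * K / (((L : ℝ) - 1) * P.coefB * P.deltaQ L D) := by gcongr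
      _ ≤ (L : ℝ) * K / ((L : ℝ) * ((D - P.dMinInf) / 4)) := by gcongr
      _ = C := by rw [hC]; field_simp; ring
  have t1 := mul_le_mul_of_nonneg_left (log_le_log_add_div f3 hd) (by linarith : (0 : ℝ) ≤ L)
  have t2 : Real.log (1 + P.kappa L * α) ≤ Real.log (P.lamY L) - Real.log P.gamY := by
    rw [← Real.log_div hl.ne' hg.ne']
    have e2 : P.lamY L / P.gamY = 1 + P.kappa L * P.lamY L := by
      rw [div_eq_iff hg.ne', mul_comm]; exact (h.gamY_mul L).symm
    rw [e2]
    exact Real.log_le_log (by positivity) (by gcongr)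
  have t3 : 0 ≤ Real.log (1 + P.kappa L * P.alphaQ L D) :=
    Real.log_nonneg (by linarith [mul_nonneg hk ha.le])
  have t4 : Real.log (P.lamY L) ≤ Real.log (L : ℝ) + Real.log (P.gamY + P.covY) := by
    rw [← Real.log_mul (by linarith) (by linarith)]
    apply Real.log_le_log hl
    rw [h.lamY_eq]; nlinarith
  have t5 : 0 ≤ Real.log (L : ℝ) := Real.log_nonneg (by linarith)
  rw [one_mul, Real.norm_of_nonneg hgap, Real.norm_of_nonneg t5, e]
  unfold payoff
  linarith

end Admissible

end SymGaussian

end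

theorem corollary1 (P : SymGaussian)
    (hvX : 0 < P.varX) (hvZ : 0 ≤ P.varZ)
    (hrX : P.rhoX ∈ Set.Icc (0 : ℝ) 1) (hrZ : P.rhoZ ∈ Set.Icc (0 : ℝ) 1)
    (hY : ∀ L : ℕ, 2 ≤ L → 0 < min (P.lamY L) P.gamY)
    (D : ℝ) (hD : D ∈ Set.Ioo P.dMinInf P.varX) :
    -- both bounds are well defined at `D` whenever `d_min < D`, in particular for large `L`
    (∀ᶠ L : ℕ in atTop, P.dMin L < D) ∧
    (∀ L : ℕ, 2 ≤ L → P.dMin L < D →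
      (∃! q : ℝ, P.IsLamQ L D q) ∧ IsLeast (P.feasibleValues L D) (P.lowerRate L D)) ∧
    -- the uncorrelated case
    (P.covY = 0 → ∀ L : ℕ, 2 ≤ L → P.dMin L < D ∧ P.gap L D = 0) ∧
    -- `ρ_X > 0` and `ξ ≥ 1/2`, where `ξ = ∞` if `ρ_X = 1`
    (0 < P.covY → 0 < P.rhoX → (P.rhoX = 1 ∨ 1 / 2 ≤ P.xi) →
      ∀ L : ℕ, 2 ≤ L → P.dMin L < D → P.gap L D = 0) ∧
    -- `ρ_X > 0` and `ξ < 1/2`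
    (0 < P.covY → 0 < P.rhoX → P.rhoX < 1 → P.xi < 1 / 2 →
      ((D ≤ P.dTh1 ∨ P.dTh2 ≤ D) → Tendsto (fun L : ℕ => P.gap L D) atTop (𝓝 0)) ∧
      (P.dTh1 < D → D < P.dTh2 →
        Tendsto (fun L : ℕ => P.gap L D) atTop (𝓝 (P.deltaInf D)))) ∧
    -- `ρ_X = 0`
    (0 < P.covY → P.rhoX = 0 →
      (fun L : ℕ => P.gap L D) =O[atTop] (fun L : ℕ => Real.log (L : ℝ))) := by
  have h : P.Admissible := ⟨hvX, hvZ, hrX.1, hrX.2, hrZ.1, hrZ.2, (lt_min_iff.1 (hY 2 le_rfl)).2⟩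
  have hg := h.gamY_pos
  obtain ⟨hD, hDX⟩ := hD
  refine ⟨h.eventually_dMin_lt hD, fun L hL hDL => ⟨h.existsUnique_isLamQ hL hDL hDX,
    (h.exists_gap_eq hL hDL hDX).1⟩, fun hc L hL => ?_, fun hc hr hxi L hL hDL => ?_,
    fun hc hr h1 hxi => ?_, fun hc hr => h.gap_isBigO_log hD hDX hc hr⟩
  · have hDL : P.dMin L < D := by rwa [h.dMin_eq_of_covY_eq_zero hc hL]
    refine ⟨hDL, h.gap_eq_zero_of_half ?_ hL hDL hDX⟩
    rw [hc, mul_zero, mul_zero]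
    exact mul_nonneg h.covX_nonneg hg.le
  · refine h.gap_eq_zero_of_half ?_ hL hDL hDX
    rcases h.rhoX_le_one.eq_or_lt with h1 | h1
    -- This is the case `ξ = +∞`: here `B = 0`, and the condition for equality is trivial.
    · have : P.gamX = 0 := by unfold SymGaussian.gamX; rw [h1]; ring
      rw [this, zero_mul, mul_zero]
      exact mul_nonneg h.covX_nonneg hg.le
    · rw [← h.xi_mul hc h1]
      have := mul_nonneg h.gamX_nonneg hc.le
      rcases hxi with h2 | h2
      · exact absurd h2 h1.ne
      · exact mul_le_mul_of_nonneg_right h2 this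
  · have hX : 0 < P.gamX := mul_pos (by linarith) hvX
    have hr' : 0 < P.rhoX * P.varX := mul_pos hr hvX
    exact ⟨h.tendsto_gap_zero hD hDX hc hr' h1 hX hxi,
      h.tendsto_gap_deltaInf hD hDX hc hr' h1 hX hxi⟩
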